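/- **Setting.** Let $d\in\{2,3\}$ and let $\Omega\subset\mathbb R^d$ be a bounded open set. Write $\|\cdot\|$, $(\cdot,\cdot)$ for the norm and inner product of $L^2(\Omega)$ (scalar, vector or matrix valued, with the Frobenius norm on matrices), $X=[H^1_0(\Omega)]^d$ (the $H^1$-closure of $C_c^\infty(\Omega;\mathbb R^d)$), $Q=L^2_0(\Omega)$ (mean-zero functions), $\|g\|_{-1}=\sup_{0\ne v\in X}(g,v)/\|\nabla v\|$, and $b^*(w,u,v)=\tfrac12(w\cdot\nabla u,v)-\tfrac12(w\cdot\nabla v,u)$. *Exact solution.* For $\nu,T>0$ let $u:[0,T]\to X$, $p:[0,T]\to Q$ be a weak solution of the Navier–Stokes equations, i.e. for almost all $t\in(0,T]$ $$(u_t,v)+(u\cdot\nabla u,v)+\nu(\nabla u,\nabla v)-(p,\nabla\cdot v)=(f,v)\ \ \forall v\in X,\qquad (\nabla\cdot u,q)=0\ \ \forall q\in Q,\qquad u(0)=u^0\in X,$$ where $f\in C([0,T];L^2)$, $u\in H^1(0,T;X)\cap H^2(0,T;L^2)$, $p\in W^{1,\infty}(0,T;L^2)$ ($u$ and $p$ being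 the representatives continuous in time). *POD spaces.* Let $\{\varphi_i\}_{i=1}^R\subset X$ and $\{\psi_i\}_{i=1}^M\subset Q$ be POD bases of finitely many velocity snapshots in $X$ and pressure snapshots in $Q$: they are $L^2$-orthonormal and minimize $\sum_n\|u_S^n-\sum_j(u_S^n,\varphi_j)\varphi_j\|^2$, respectively $\sum_n\|p_S^n-\sum_j(p_S^n,\psi_j)\psi_j\|^2$, among $L^2$-orthonormal families of the same length in $X$, respectively $Q$. Let $X_R=\mathrm{span}\{\varphi_i\}$, $Q_M=\mathrm{span}\{\psi_i\}$, let $P_R$, $\chi_M$ be the $L^2$ projections onto $X_R$, $Q_M$, and let $\alpha=\cos\theta_1$, where $$\theta_1=\min\Big\{\arccos\frac{|(v,\psi)|}{\|v\|\|\psi\|}: v\in\mathrm{span}\{\nabla\cdot\varphi_i\},\ \psi\in Q_M\Big\}\in[0,\tfrac\pi2]$$ is the first principal angle (pairs with a zero vector count as $\pi/2$). *AC-ROM.* Let $N\ge1$, $\Delta t=T/N$, $t_n=n\Delta t$, $g^n=g(t_n)$ for a function $g$ of time, and $\varepsilon>0$. Let $u_R^n\in X_R$, $p_M^n\in Q_M$,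 $0\le n\le N$, satisfy for $0\le n\le N-1$ $$\Big(\tfrac{u_R^{n+1}-u_R^n}{\Delta t},\varphi\Big)+b^*(u_R^n,u_R^{n+1},\varphi)+\nu(\nabla u_R^{n+1},\nabla\varphi)-(p_M^{n+1},\nabla\cdot\varphi)=(f^{n+1},\varphi)\ \ \forall\varphi\in X_R,$$ $$\varepsilon\Big(\tfrac{p_M^{n+1}-p_M^n}{\Delta t},\psi\Big)+(\nabla\cdot u_R^{n+1},\psi)=0\ \ \forall\psi\in Q_M .$$ *Errors.* Put $e_u^n=u^n-u_R^n$, $\eta^n=u^n-P_Ru^n$, $\xi_R^n=u_R^n-P_Ru^n$, $e_p^n=p^n-p_M^n$, $\kappa^n=p^n-\chi_Mp^n$, $\pi_M^n=p_M^n-\chi_Mp^n$, $|||v|||_{2,0}^2=\Delta t\sum_{n=0}^N\|v^n\|^2$, and $$\mathcal E(a,b)=\|a^N\|^2+\varepsilon\|b^N\|^2+\tfrac{\nu\Delta t}2\|\nabla a^N\|^2+\tfrac\nu2|||\nabla a|||_{2,0}^2+\sum_{n=0}^{N-1}\Big(\|a^{n+1}-a^n\|^2+\tfrac\varepsilon2\|b^{n+1}-b^n\|^2\Big).$$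 **Theorem 5.1.** For all $\nu_0>0$, $c_1>0$, $c_2$ and $K$ there are constants $C,\widetilde C>0$, depending only on these numbers and on $\Omega$ and $d$, with the following property. Suppose in the above setting that $\nu\le\nu_0$, that $\varepsilon$ is of the order of $\Delta t$ in the sense $c_1\Delta t\le\varepsilon\le c_2\Delta t$, that $\sup_{[0,T]}\|\nabla u\|\le K$, and that $$\|u_R^0\|^2+\nu\Delta t\|\nabla u_R^0\|^2+\varepsilon\|p_M^0\|^2+\frac{4\Delta t}{\nu}\sum_{n=0}^{N-1}\|f^{n+1}\|_{-1}^2\le K .$$ Then $$\begin{aligned}\mathcal E(e_u,e_p)\le{}&\mathcal E(\eta,\kappa)+C\exp\Big(\frac{\widetilde CT}{\nu^3}\Big)\bigg(\|\xi_R^0\|^2+\varepsilon\|\pi_M^0\|^2+\Delta t\,\nu\|\nabla\xi_R^0\|^2\\&+\Big(\frac1\nu+\alpha^2\Delta t^{-1}\Big)|||\nabla\eta|||_{2,0}^2+\frac1\nu|||\kappa|||_{2,0}^2+\frac{\Delta t^2}\nu\|u_{tt}\|_{L^2(0,T;L^2)}^2+\frac{\Delta t^2}\nu\|\nabla u_t\|_{L^2(0,T;L^2)}^2\\&+\frac{\Delta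 t^{1/2}}{\nu^{3/2}}\Big(\sum_{n=0}^{N-1}\|\nabla\eta^{n+1}\|^4\Big)^{1/2}+\Delta t^3\|p_t\|_{L^2(0,T;L^2)}^2+\Delta t\,\|p_t\|_{L^\infty(0,T;L^2)}^2\bigg).\end{aligned}$$ -/

import Mathlib

open MeasureTheory Set
open scoped ContDiff

noncomputable section

namespace ACROM

variable {d : ℕ}

/-- The physical space `ℝ^d` with its Euclidean norm. -/
abbrev Pt (d : ℕ) : Type := EuclideanSpace ℝ (Fin d)

/-- `d × d` matrices with the Frobenius norm; the entry `(i, j)` of a gradient is `∂_j v_i`. -/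
abbrev Mat (d : ℕ) : Type := EuclideanSpace ℝ (Fin d × Fin d)

/-- `L²(Ω)`. -/
abbrev L2S (Ω : Set (Pt d)) : Type := Lp ℝ 2 (volume.restrict Ω)

/-- `[L²(Ω)]^d`. -/
abbrev L2V (Ω : Set (Pt d)) : Type := Lp (Pt d) 2 (volume.restrict Ω)

/-- `[L²(Ω)]^{d×d}`. -/
abbrev L2M (Ω : Set (Pt d)) : Type := Lp (Mat d) 2 (volume.restrict Ω)

/-- The classical Jacobian matrix `(∂_j φ_i)_{i,j}` of a vector field. -/
def jacobian (φ : Pt d → Pt d) (x : Pt d) : Mat d :=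
  WithLp.toLp 2 fun ij => fderiv ℝ φ x (EuclideanSpace.single ij.2 1) ij.1

/-- The pairs `(φ, ∇φ)` with `φ ∈ C_c^∞(Ω; ℝ^d)`. -/
def testPairs (Ω : Set (Pt d)) : Set (L2V Ω × L2M Ω) :=
  {z | ∃ φ : Pt d → Pt d, ContDiff ℝ ∞ φ ∧ HasCompactSupport φ ∧ tsupport φ ⊆ Ω ∧
    z.1 =ᵐ[volume.restrict Ω] φ ∧ z.2 =ᵐ[volume.restrict Ω] jacobian φ}

/-- `X = [H¹₀(Ω)]^d`, the closure of `C_c^∞(Ω; ℝ^d)` in `H¹`. A member `v` is stored together with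
its weak gradient as the pair `(v, ∇v)`; the product norm is equivalent to the `H¹` norm. -/
def X (Ω : Set (Pt d)) : Submodule ℝ (L2V Ω × L2M Ω) :=
  (Submodule.span ℝ (testPairs Ω)).topologicalClosure

/-- `X` is complete, so that Bochner integrals of `X`-valued functions are meaningful. -/
instance (Ω : Set (Pt d)) : CompleteSpace (X Ω) :=
  (Submodule.isClosed_topologicalClosure _).completeSpace_coe

/-- The embedding `X ⊂ [L²(Ω)]^d`. -/
def vel {Ω : Set (Pt d)} : X Ω →L[ℝ] L2V Ω :=
  (ContinuousLinearMap.fst ℝ (L2V Ω) (L2M Ω)).comp (X Ω).subtypeL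

/-- The weak gradient. -/
def grad {Ω : Set (Pt d)} : X Ω →L[ℝ] L2M Ω :=
  (ContinuousLinearMap.snd ℝ (L2V Ω) (L2M Ω)).comp (X Ω).subtypeL

/-- The trace of a matrix. -/
def matTrace : Mat d →L[ℝ] ℝ := ∑ i : Fin d, EuclideanSpace.proj (i, i)

/-- The weak divergence, the trace of the weak gradient. -/
def divg {Ω : Set (Pt d)} : X Ω →L[ℝ] L2S Ω :=
  ((matTrace (d := d)).compLpL 2 (volume.restrict Ω)).comp grad

/-- Membership in `Q = L²₀(Ω)`: the mean value vanishes. -/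
def MeanZero {Ω : Set (Pt d)} (q : L2S Ω) : Prop := ∫ x in Ω, q x = 0

/-- `b(w, u, v) = (w · ∇u, v)`. -/
def convForm {Ω : Set (Pt d)} (w u v : X Ω) : ℝ :=
  ∫ x in Ω, ∑ i : Fin d, ∑ j : Fin d, vel w x j * grad u x (i, j) * vel v x i

/-- `b*(w, u, v) = ½ (w · ∇u, v) - ½ (w · ∇v, u)`. -/
def skewForm {Ω : Set (Pt d)} (w u v : X Ω) : ℝ :=
  1 / 2 * convForm w u v - 1 / 2 * convForm w v u

/-- `‖g‖₋₁ = sup_{0 ≠ v ∈ X} (g, v) / ‖∇v‖` (the value at `v = 0` is `0 / 0 = 0`). -/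
def negNorm {Ω : Set (Pt d)} (g : L2V Ω) : ℝ :=
  ⨆ v : X Ω, inner ℝ g (vel v) / ‖grad v‖

/-- `(u, p)` is a weak solution of the Navier–Stokes equations on `(0, T]` with viscosity `ν`,
force `f` and initial velocity `u₀`; `ut` is the time derivative of `u`. -/
structure IsWeakNSE (Ω : Set (Pt d)) (ν T : ℝ) (f : ℝ → L2V Ω) (u₀ : X Ω)
    (u ut : ℝ → X Ω) (p : ℝ → L2S Ω) : Prop where
  momentum : ∀ᵐ t ∂(volume.restrict (Ioc 0 T)), ∀ v : X Ω,
    inner ℝ (vel (ut t)) (vel v) + convForm (u t) (u t) v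
      + ν * inner ℝ (grad (u t)) (grad v) - inner ℝ (p t) (divg v) = inner ℝ (f t) (vel v)
  continuity : ∀ᵐ t ∂(volume.restrict (Ioc 0 T)), ∀ q : L2S Ω, MeanZero q →
    inner ℝ (divg (u t)) q = 0
  initial : u 0 = u₀
  pressure_mean : ∀ t ∈ Icc 0 T, MeanZero (p t)

/-- Regularity in time: `f ∈ C([0,T]; L²)`, `u ∈ H¹(0,T; X) ∩ H²(0,T; L²)`,
`p ∈ W^{1,∞}(0,T; L²)`, with `u`, `p` the representatives that are continuous in time and with
(Bochner) time derivatives `ut`, `utt`, `pt`. -/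
structure IsTimeRegular (Ω : Set (Pt d)) (T : ℝ) (f : ℝ → L2V Ω) (u ut : ℝ → X Ω)
    (utt : ℝ → L2V Ω) (p pt : ℝ → L2S Ω) : Prop where
  f_cont : ContinuousOn f (Icc 0 T)
  ut_mem : MemLp ut 2 (volume.restrict (Ioc 0 T))
  u_eq : ∀ t ∈ Icc 0 T, u t = u 0 + ∫ s in (0 : ℝ)..t, ut s
  utt_mem : MemLp utt 2 (volume.restrict (Ioc 0 T))
  ut_eq : ∃ a : L2V Ω, ∀ᵐ t ∂(volume.restrict (Ioc 0 T)),
    vel (ut t) = a + ∫ s in (0 : ℝ)..t, utt s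
  pt_mem : MemLp pt ⊤ (volume.restrict (Ioc 0 T))
  p_eq : ∀ t ∈ Icc 0 T, p t = p 0 + ∫ s in (0 : ℝ)..t, pt s

/-- `φ` is a velocity POD basis of the snapshots `s`: it is `L²`-orthonormal and minimizes
`∑_n ‖s_n - ∑_j (s_n, φ_j) φ_j‖²` among the `L²`-orthonormal families of the same length in `X`. -/
def IsVelPOD {Ω : Set (Pt d)} {k R : ℕ} (s : Fin k → X Ω) (φ : Fin R → X Ω) : Prop :=
  Orthonormal ℝ (fun j => vel (φ j)) ∧
  ∀ χ : Fin R → X Ω, Orthonormal ℝ (fun j => vel (χ j)) →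
    ∑ n, ‖vel (s n) - ∑ j, inner ℝ (vel (s n)) (vel (φ j)) • vel (φ j)‖ ^ 2
      ≤ ∑ n, ‖vel (s n) - ∑ j, inner ℝ (vel (s n)) (vel (χ j)) • vel (χ j)‖ ^ 2

/-- `ψ` is a pressure POD basis of the snapshots `s`, within `Q = L²₀(Ω)`. -/
def IsPresPOD {Ω : Set (Pt d)} {k M : ℕ} (s : Fin k → L2S Ω) (ψ : Fin M → L2S Ω) : Prop :=
  Orthonormal ℝ ψ ∧ (∀ j, MeanZero (ψ j)) ∧
  ∀ χ : Fin M → L2S Ω, Orthonormal ℝ χ → (∀ j, MeanZero (χ j)) →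
    ∑ n, ‖s n - ∑ j, inner ℝ (s n) (ψ j) • ψ j‖ ^ 2
      ≤ ∑ n, ‖s n - ∑ j, inner ℝ (s n) (χ j) • χ j‖ ^ 2

/-- The `L²` projection of `v` onto `X_R = span {φ_i}`, for `L²`-orthonormal `φ`. -/
def velProj {Ω : Set (Pt d)} {R : ℕ} (φ : Fin R → X Ω) (v : X Ω) : X Ω :=
  ∑ i, inner ℝ (vel v) (vel (φ i)) • φ i

/-- The `L²` projection of `q` onto `Q_M = span {ψ_i}`, for orthonormal `ψ`. -/
def presProj {Ω : Set (Pt d)} {M : ℕ} (ψ : Fin M → L2S Ω) (q : L2S Ω) : L2S Ω :=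
  ∑ i, inner ℝ q (ψ i) • ψ i

theorem velProj_orthogonal {Ω : Set (Pt d)} {R : ℕ} {φ : Fin R → X Ω}
    (hφ : Orthonormal ℝ (fun j => vel (φ j))) (v w : X Ω)
    (hw : w ∈ Submodule.span ℝ (range φ)) : inner ℝ (vel (v - velProj φ v)) (vel w) = 0 := by
  induction hw using Submodule.span_induction with
  | mem x hx =>
    obtain ⟨k, rfl⟩ := hx
    have h : ∀ i, inner ℝ (vel (φ i)) (vel (φ k)) = if i = k then (1 : ℝ) else 0 :=
      orthonormal_iff_ite.mp hφ |> fun h i => h i k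
    simp [velProj, inner_sub_left, sum_inner, inner_smul_left, h]
  | zero => simp
  | add x y _ _ hx hy => rw [map_add, inner_add_right, hx, hy, add_zero]
  | smul a x _ hx => rw [map_smul, inner_smul_right, hx, mul_zero]

theorem presProj_orthogonal {Ω : Set (Pt d)} {M : ℕ} {ψ : Fin M → L2S Ω}
    (hψ : Orthonormal ℝ ψ) (q r : L2S Ω)
    (hr : r ∈ Submodule.span ℝ (range ψ)) : inner ℝ (q - presProj ψ q) r = 0 := by
  induction hr using Submodule.span_induction with
  | mem x hx =>
    obtain ⟨k, rfl⟩ := hx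
    have h : ∀ i, inner ℝ (ψ i) (ψ k) = if i = k then (1 : ℝ) else 0 :=
      orthonormal_iff_ite.mp hψ |> fun h i => h i k
    simp [presProj, inner_sub_left, sum_inner, inner_smul_left, h]
  | zero => simp
  | add x y _ _ hx hy => rw [inner_add_right, hx, hy, add_zero]
  | smul a x _ hx => rw [inner_smul_right, hx, mul_zero]

/-- `(uR^n, pM^n)`, `n = 0, …, N`, solves the AC-ROM scheme on `XR × QM` with time step `Δt`,
artificial compression parameter `ε` and force values `f^n`. -/
structure IsACROM {Ω : Set (Pt d)} (XR : Submodule ℝ (X Ω)) (QM : Submodule ℝ (L2S Ω))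
    (ν ε Δt : ℝ) (N : ℕ) (f : ℕ → L2V Ω) (uR : ℕ → X Ω) (pM : ℕ → L2S Ω) : Prop where
  mem_XR : ∀ n ≤ N, uR n ∈ XR
  mem_QM : ∀ n ≤ N, pM n ∈ QM
  velocity : ∀ n < N, ∀ φ ∈ XR,
    inner ℝ (Δt⁻¹ • (vel (uR (n + 1)) - vel (uR n))) (vel φ)
      + skewForm (uR n) (uR (n + 1)) φ + ν * inner ℝ (grad (uR (n + 1))) (grad φ)
      - inner ℝ (pM (n + 1)) (divg φ) = inner ℝ (f (n + 1)) (vel φ)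
  pressure : ∀ n < N, ∀ ψ ∈ QM,
    ε * inner ℝ (Δt⁻¹ • (pM (n + 1) - pM n)) ψ + inner ℝ (divg (uR (n + 1))) ψ = 0

/-- The first principal angle between two subspaces. A pair with a zero vector contributes
`arccos (0 / 0) = arccos 0 = π / 2`, the largest possible value. -/
def firstPrincipalAngle {H : Type*} [NormedAddCommGroup H] [InnerProductSpace ℝ H]
    (A B : Submodule ℝ H) : ℝ :=
  sInf {θ | ∃ v ∈ A, ∃ ψ ∈ B, θ = Real.arccos (|inner ℝ v ψ| / (‖v‖ * ‖ψ‖))}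

/-- `α = cos θ₁` for the spaces `span {∇·φ_i}` and `span {ψ_i}`. -/
def angleCos {Ω : Set (Pt d)} {R M : ℕ} (φ : Fin R → X Ω) (ψ : Fin M → L2S Ω) : ℝ :=
  Real.cos (firstPrincipalAngle
    (Submodule.span ℝ (range fun i => divg (φ i))) (Submodule.span ℝ (range ψ)))

/-- The square of the discrete norm `|||v|||_{2,0}`, that is `Δt ∑_{n=0}^{N} ‖v^n‖²`. -/
def discL2sq {H : Type*} [NormedAddCommGroup H] (Δt : ℝ) (N : ℕ) (v : ℕ → H) : ℝ :=
  Δt * ∑ n ∈ Finset.range (N + 1), ‖v n‖ ^ 2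

/-- The energy functional that measures velocity errors `a^n` and pressure errors `b^n`:
`‖a^N‖² + ε‖b^N‖² + (νΔt/2)‖∇a^N‖² + (ν/2)|||∇a|||²_{2,0}
  + ∑_{n=0}^{N-1} (‖a^{n+1} - a^n‖² + (ε/2)‖b^{n+1} - b^n‖²)`. -/
def errEnergy {Ω : Set (Pt d)} (ν ε Δt : ℝ) (N : ℕ) (a : ℕ → X Ω) (b : ℕ → L2S Ω) : ℝ :=
  ‖vel (a N)‖ ^ 2 + ε * ‖b N‖ ^ 2 + ν * Δt / 2 * ‖grad (a N)‖ ^ 2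
    + ν / 2 * discL2sq Δt N (fun n => grad (a n))
    + ∑ n ∈ Finset.range N, (‖vel (a (n + 1)) - vel (a n)‖ ^ 2
        + ε / 2 * ‖b (n + 1) - b n‖ ^ 2)

end ACROM

end

/-!
Subtracting the scheme from the Navier–Stokes equations at the time nodes and testing with the
discrete errors `ξ`, `π`, which lie in the reduced spaces, makes the coupling of `π` with `∇·ξ`
cancel, so that of the pressure terms essentially `(∇·η, π)` remains. It is at most
`α ‖∇·η‖ ‖π‖`, and since `ε ~ Δt` Young's inequality turns it into `α² ‖∇η‖²` plus terms absorbed by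
the energy and by the dissipated pressure increments. The convection term with `ξ` at the old
time level grows only like `‖ξ‖^(1/2) ‖∇ξ‖^(1/2)`, so that Young's inequality against the viscosity
leaves `ν⁻³ ‖ξ‖²` for the discrete Gronwall lemma. Finally `η` and `κ` are orthogonal to the
reduced spaces, which splits all but the gradient terms of the total error exactly.
-/

open scoped ENNReal NNReal Topology

noncomputable section

namespace ACROM

variable {d : ℕ} {Ω : Set (Pt d)}

/-! ### Test functions -/

lemma jacobian_apply (φ : Pt d → Pt d) (x : Pt d) (ij : Fin d × Fin d) :
    jacobian φ x ij = fderiv ℝ φ x (EuclideanSpace.single ij.2 1) ij.1 := rfl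

lemma fderiv_apply_apply (φ : Pt d → Pt d) (x y : Pt d) (i : Fin d) :
    fderiv ℝ φ x y i = ∑ j, jacobian φ x (i, j) * y j := by
  have hy : y = ∑ j, y j • EuclideanSpace.single j (1 : ℝ) := by
    ext i
    simp [Pi.single_apply]
  conv_lhs => rw [hy]
  simp [jacobian_apply, mul_comm]

lemma continuous_jacobian {φ : Pt d → Pt d} (hφ : ContDiff ℝ 1 φ) : Continuous (jacobian φ) := by
  refine (PiLp.continuous_toLp 2 _).comp (continuous_pi fun ij => ?_)
  have hfderiv : Continuous (fderiv ℝ φ) := hφ.continuous_fderiv one_ne_zero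
  exact (EuclideanSpace.proj ij.1).continuous.comp (hfderiv.clm_apply continuous_const)

lemma norm_fderiv_le_norm_jacobian (φ : Pt d → Pt d) (x : Pt d) :
    ‖fderiv ℝ φ x‖ ≤ ‖jacobian φ x‖ := by
  refine ContinuousLinearMap.opNorm_le_bound _ (norm_nonneg _) fun y => ?_
  rw [← sq_le_sq₀ (norm_nonneg _) (by positivity), mul_pow, EuclideanSpace.real_norm_sq_eq,
    EuclideanSpace.real_norm_sq_eq, EuclideanSpace.real_norm_sq_eq, Fintype.sum_prod_type,
    Finset.sum_mul]
  refine Finset.sum_le_sum fun i _ => ?_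
  rw [fderiv_apply_apply]
  exact Finset.sum_mul_sq_le_sq_mul_sq _ _ _

lemma jacobian_zero : jacobian (0 : Pt d → Pt d) = 0 := by
  ext x ij
  simp [jacobian_apply]

lemma jacobian_add {φ χ : Pt d → Pt d} (hφ : Differentiable ℝ φ) (hχ : Differentiable ℝ χ) :
    jacobian (φ + χ) = jacobian φ + jacobian χ := by
  ext x ij
  simp [jacobian_apply, fderiv_add (hφ x) (hχ x)]

lemma jacobian_const_smul (c : ℝ) {φ : Pt d → Pt d} (hφ : Differentiable ℝ φ) :
    jacobian (c • φ) = c • jacobian φ := by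
  ext x ij
  simp [jacobian_apply, fderiv_const_smul (hφ x)]

lemma zero_mem_testPairs : (0 : L2V Ω × L2M Ω) ∈ testPairs Ω :=
  ⟨0, contDiff_zero_fun, HasCompactSupport.zero, by simp, Lp.coeFn_zero _ _ _,
    jacobian_zero (d := d) ▸ Lp.coeFn_zero _ _ _⟩

lemma add_mem_testPairs {y z : L2V Ω × L2M Ω} (hy : y ∈ testPairs Ω) (hz : z ∈ testPairs Ω) :
    y + z ∈ testPairs Ω := by
  obtain ⟨φ, hφ, hφc, hφs, hφ1, hφ2⟩ := hy
  obtain ⟨χ, hχ, hχc, hχs, hχ1, hχ2⟩ := hz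
  refine ⟨φ + χ, hφ.add hχ, hφc.add hχc, (tsupport_add φ χ).trans (union_subset hφs hχs),
    (Lp.coeFn_add _ _).trans (hφ1.add hχ1), ?_⟩
  rw [jacobian_add (hφ.differentiable (by simp)) (hχ.differentiable (by simp))]
  exact (Lp.coeFn_add _ _).trans (hφ2.add hχ2)

lemma smul_mem_testPairs (c : ℝ) {z : L2V Ω × L2M Ω} (hz : z ∈ testPairs Ω) :
    c • z ∈ testPairs Ω := by
  obtain ⟨φ, hφ, hφc, hφs, hφ1, hφ2⟩ := hz
  refine ⟨c • φ, contDiff_const.smul hφ, hφc.smul_left (f := fun _ => c),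
    (tsupport_smul_subset_right (fun _ => c) φ).trans hφs,
    (Lp.coeFn_smul _ _).trans (hφ1.const_smul c), ?_⟩
  rw [jacobian_const_smul c (hφ.differentiable (by simp))]
  exact (Lp.coeFn_smul _ _).trans (hφ2.const_smul c)

lemma dense_testPairs : Dense {v : X Ω | (v : L2V Ω × L2M Ω) ∈ testPairs Ω} := by
  let S : Submodule ℝ (L2V Ω × L2M Ω) :=
    { carrier := testPairs Ω
      add_mem' := add_mem_testPairs
      zero_mem' := zero_mem_testPairs
      smul_mem' := fun c _ hz => smul_mem_testPairs c hz }
  have hspan : (Submodule.span ℝ (testPairs Ω) : Set (L2V Ω × L2M Ω)) ⊆ testPairs Ω :=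
    Submodule.span_le.mpr (show testPairs Ω ⊆ (S : Set _) from subset_rfl)
  refine Subtype.dense_iff.mpr (closure_mono (hspan.trans fun z hz => ?_))
  exact ⟨⟨z, Submodule.le_topologicalClosure _ (Submodule.subset_span hz)⟩, hz, rfl⟩

/-! ### Sobolev and Poincaré inequalities -/

lemma lowerSemicontinuous_eLpNorm {α E : Type*} [MeasurableSpace α] [NormedAddCommGroup E]
    {μ : Measure α} {p : ℝ≥0∞} [Fact (1 ≤ p)] (q : ℝ≥0∞) :
    LowerSemicontinuous fun f : Lp E p μ => eLpNorm f q μ := by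
  refine lowerSemicontinuous_iff_isClosed_preimage.mpr fun y => IsSeqClosed.isClosed ?_
  intro f g hf hfg
  obtain ⟨k, -, hae⟩ := (tendstoInMeasure_of_tendsto_Lp hfg).exists_seq_tendsto_ae
  refine (Lp.eLpNorm_lim_le_liminf_eLpNorm
    (fun n => Lp.aestronglyMeasurable (f (k n))) g hae).trans ?_
  exact Filter.liminf_le_of_le (by isBoundedDefault) fun b hb =>
    let ⟨n, hn⟩ := hb.exists; hn.trans (hf (k n))

lemma exists_eLpNorm_le_eLpNorm_jacobian {p q : ℝ≥0} (hp : 1 ≤ p) (hp2 : p ≤ 2)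
    (hpd : (p : ℝ) < d) (hpq : (p : ℝ)⁻¹ - (d : ℝ)⁻¹ ≤ (q : ℝ)⁻¹)
    (hΩ : Bornology.IsBounded Ω) :
    ∃ C : ℝ≥0, ∀ φ : Pt d → Pt d, ContDiff ℝ 1 φ → tsupport φ ⊆ Ω →
      eLpNorm φ q (volume.restrict Ω) ≤ C * eLpNorm (jacobian φ) 2 (volume.restrict Ω) := by
  have hexp : 0 ≤ 1 / (p : ℝ) - 1 / 2 := sub_nonneg.mpr <|
    one_div_le_one_div_of_le (by exact_mod_cast zero_lt_one.trans_le hp) (by exact_mod_cast hp2)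
  let S := eLpNormLESNormFDerivOfLeConst (Pt d) (volume : Measure (Pt d)) Ω p q
  refine ⟨S * (volume Ω ^ (1 / (p : ℝ) - 1 / 2)).toNNReal, fun φ hφ hs => ?_⟩
  have hsobolev : eLpNorm φ q volume ≤ S * eLpNorm (fderiv ℝ φ) p volume :=
    eLpNorm_le_eLpNorm_fderiv_of_le (volume : Measure (Pt d)) hφ
      ((subset_tsupport φ).trans hs) hp
      (by rw [finrank_euclideanSpace_fin]; exact_mod_cast hpd)
      (by rw [finrank_euclideanSpace_fin]; exact_mod_cast hpq) hΩ
  have hfderiv : eLpNorm (fderiv ℝ φ) p volume ≤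
      eLpNorm (jacobian φ) 2 (volume.restrict Ω) * volume Ω ^ (1 / (p : ℝ) - 1 / 2) := by
    rw [← eLpNorm_restrict_eq_of_support_subset (f := fderiv ℝ φ)
      ((support_fderiv_subset ℝ).trans hs)]
    refine (eLpNorm_mono (norm_fderiv_le_norm_jacobian φ)).trans ?_
    simpa using eLpNorm_le_eLpNorm_mul_rpow_measure_univ (μ := volume.restrict Ω)
      (p := p) (q := 2) (by exact_mod_cast hp2) (continuous_jacobian hφ).aestronglyMeasurable
  calc eLpNorm φ q (volume.restrict Ω) ≤ eLpNorm φ q volume :=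
        eLpNorm_mono_measure _ Measure.restrict_le_self
    _ ≤ S * (eLpNorm (jacobian φ) 2 (volume.restrict Ω) *
        volume Ω ^ (1 / (p : ℝ) - 1 / 2)) := hsobolev.trans (by gcongr)
    _ = _ := by
        rw [ENNReal.coe_mul, ENNReal.coe_toNNReal
          (ENNReal.rpow_lt_top_of_nonneg hexp hΩ.measure_lt_top.ne).ne]
        ring

lemma exists_eLpNorm_six_le (hd : d = 2 ∨ d = 3) (hΩ : Bornology.IsBounded Ω) :
    ∃ C : ℝ≥0, ∀ v : X Ω, eLpNorm (vel v) 6 (volume.restrict Ω) ≤ C * ‖grad v‖ₑ := by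
  obtain ⟨p, hp, hp2, hpd, hpq⟩ : ∃ p : ℝ≥0, 1 ≤ p ∧ p ≤ 2 ∧ (p : ℝ) < d ∧
      (p : ℝ)⁻¹ - (d : ℝ)⁻¹ ≤ ((6 : ℝ≥0) : ℝ)⁻¹ := by
    rcases hd with rfl | rfl
    · exact ⟨3 / 2, by rw [← NNReal.coe_le_coe]; norm_num, by rw [← NNReal.coe_le_coe]; norm_num,
        by norm_num, by norm_num⟩
    · exact ⟨2, by norm_num, le_rfl, by norm_num, by norm_num⟩
  obtain ⟨C, hC⟩ := exists_eLpNorm_le_eLpNorm_jacobian hp hp2 hpd hpq hΩ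
  refine ⟨C, dense_testPairs.induction ?_ ?_⟩
  · rintro v ⟨φ, hφ, -, hφs, hvφ, hgφ⟩
    rw [Lp.enorm_def, eLpNorm_congr_ae (f := vel v) hvφ, eLpNorm_congr_ae (f := grad v) hgφ]
    exact hC φ (hφ.of_le (by simp)) hφs
  · have hcont : Continuous fun v : X Ω => (vel v, (C : ℝ≥0∞) * ‖grad v‖ₑ) :=
      vel.continuous.prodMk ((ENNReal.continuous_const_mul ENNReal.coe_ne_top).comp
        (continuous_enorm.comp grad.continuous))
    exact (lowerSemicontinuous_eLpNorm 6).isClosed_epigraph.preimage hcont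

lemma exists_norm_vel_le (hd : d = 2 ∨ d = 3) (hΩ : Bornology.IsBounded Ω) :
    ∃ C : ℝ, 0 ≤ C ∧ ∀ v : X Ω, ‖vel v‖ ≤ C * ‖grad v‖ := by
  obtain ⟨C, hC⟩ := exists_eLpNorm_six_le hd hΩ
  have hΩfin : volume Ω ^ (1 / 2 - 1 / 6 : ℝ) ≠ ⊤ :=
    (ENNReal.rpow_lt_top_of_nonneg (by norm_num) hΩ.measure_lt_top.ne).ne
  refine ⟨C * (volume Ω ^ (1 / 2 - 1 / 6 : ℝ)).toReal, by positivity, fun v => ?_⟩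
  have hle : ‖vel v‖ₑ ≤ C * ‖grad v‖ₑ * volume Ω ^ (1 / 2 - 1 / 6 : ℝ) := by
    calc ‖vel v‖ₑ ≤ eLpNorm (vel v) 6 (volume.restrict Ω) * volume Ω ^ (1 / 2 - 1 / 6 : ℝ) := by
          simpa [Lp.enorm_def] using eLpNorm_le_eLpNorm_mul_rpow_measure_univ
            (p := 2) (q := 6) (by norm_num) (Lp.aestronglyMeasurable (vel v))
      _ ≤ _ := by gcongr; exact hC v
  have hreal := ENNReal.toReal_mono
    (ENNReal.mul_ne_top (ENNReal.mul_ne_top ENNReal.coe_ne_top enorm_ne_top) hΩfin) hle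
  simp only [ENNReal.toReal_mul, toReal_enorm, ENNReal.coe_toReal] at hreal
  linarith

/-! ### The convection form -/

/-- The integrand `(a · G) b = ∑ᵢⱼ aⱼ Gᵢⱼ bᵢ` of the convection form. -/
def convIntegrand (a : Pt d) (G : Mat d) (b : Pt d) : ℝ :=
  ∑ i : Fin d, ∑ j : Fin d, a j * G (i, j) * b i

lemma convForm_eq_integral (w u v : X Ω) :
    convForm w u v = ∫ x in Ω, convIntegrand (vel w x) (grad u x) (vel v x) := rfl

lemma abs_convIntegrand_le (a : Pt d) (G : Mat d) (b : Pt d) :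
    |convIntegrand a G b| ≤ ‖a‖ * ‖G‖ * ‖b‖ := by
  refine abs_le_of_sq_le_sq ?_ (by positivity)
  have hsum : convIntegrand a G b = ∑ ij : Fin d × Fin d, G ij * (b ij.1 * a ij.2) := by
    rw [convIntegrand, Fintype.sum_prod_type]
    exact Finset.sum_congr rfl fun i _ => Finset.sum_congr rfl fun j _ => by ring
  have hprod : ∑ ij : Fin d × Fin d, (b ij.1 * a ij.2) ^ 2 = ‖b‖ ^ 2 * ‖a‖ ^ 2 := by
    rw [EuclideanSpace.real_norm_sq_eq, EuclideanSpace.real_norm_sq_eq, Fintype.sum_prod_type,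
      Finset.sum_mul_sum]
    exact Finset.sum_congr rfl fun i _ => Finset.sum_congr rfl fun j _ => by ring
  calc convIntegrand a G b ^ 2
      ≤ (∑ ij, G ij ^ 2) * ∑ ij : Fin d × Fin d, (b ij.1 * a ij.2) ^ 2 := by
        rw [hsum]; exact Finset.sum_mul_sq_le_sq_mul_sq _ _ _
    _ = _ := by rw [hprod, ← EuclideanSpace.real_norm_sq_eq]; ring

lemma aestronglyMeasurable_convIntegrand {α : Type*} [MeasurableSpace α] {μ : Measure α}
    {f h : α → Pt d} {g : α → Mat d} (hf : AEStronglyMeasurable f μ)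
    (hg : AEStronglyMeasurable g μ) (hh : AEStronglyMeasurable h μ) :
    AEStronglyMeasurable (fun x => convIntegrand (f x) (g x) (h x)) μ := by
  refine Finset.aestronglyMeasurable_fun_sum _ fun i _ =>
    Finset.aestronglyMeasurable_fun_sum _ fun j _ => ?_
  exact (((EuclideanSpace.proj j : Pt d →L[ℝ] ℝ).continuous.comp_aestronglyMeasurable hf).mul
    ((EuclideanSpace.proj (i, j) : Mat d →L[ℝ] ℝ).continuous.comp_aestronglyMeasurable hg)).mul
    ((EuclideanSpace.proj i : Pt d →L[ℝ] ℝ).continuous.comp_aestronglyMeasurable hh)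

-- Hölder with exponents 3, 2, 6, the `L³` norm of `f` being interpolated between `L²` and `L⁶`.
lemma lintegral_mul_mul_le {α : Type*} [MeasurableSpace α] {μ : Measure α} {f g h : α → ℝ≥0∞}
    (hf : AEMeasurable f μ) (hg : AEMeasurable g μ) (hh : AEMeasurable h μ) :
    ∫⁻ x, f x * g x * h x ∂μ ≤
      (∫⁻ x, f x ^ (2 : ℝ) ∂μ) ^ (1 / 4 : ℝ) * (∫⁻ x, f x ^ (6 : ℝ) ∂μ) ^ (1 / 12 : ℝ)
        * (∫⁻ x, g x ^ (2 : ℝ) ∂μ) ^ (1 / 2 : ℝ) * (∫⁻ x, h x ^ (6 : ℝ) ∂μ) ^ (1 / 6 : ℝ) := by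
  have hholder := ENNReal.lintegral_prod_norm_pow_le (μ := μ) (Finset.univ : Finset (Fin 4))
    (f := ![fun x => f x ^ (2 : ℝ), fun x => f x ^ (6 : ℝ), fun x => g x ^ (2 : ℝ),
      fun x => h x ^ (6 : ℝ)]) (p := ![1 / 4, 1 / 12, 1 / 2, 1 / 6])
    (by
      intro i _
      fin_cases i
      · exact hf.pow_const _
      · exact hf.pow_const _
      · exact hg.pow_const _
      · exact hh.pow_const _)
    (by simp [Fin.sum_univ_four]; norm_num)
    (by intro i _; fin_cases i <;> simp)
  simp only [Fin.prod_univ_four] at hholder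
  refine le_trans (le_of_eq (lintegral_congr fun x => ?_)) hholder
  change _ = (f x ^ (2 : ℝ)) ^ (1 / 4 : ℝ) * (f x ^ (6 : ℝ)) ^ (1 / 12 : ℝ) *
    (g x ^ (2 : ℝ)) ^ (1 / 2 : ℝ) * (h x ^ (6 : ℝ)) ^ (1 / 6 : ℝ)
  rw [← ENNReal.rpow_mul, ← ENNReal.rpow_mul, ← ENNReal.rpow_mul, ← ENNReal.rpow_mul,
    ← ENNReal.rpow_add_of_nonneg _ _ (by norm_num) (by norm_num)]
  norm_num

lemma lintegral_enorm_mul_mul_le {α E F G : Type*} [MeasurableSpace α] [NormedAddCommGroup E]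
    [NormedAddCommGroup F] [NormedAddCommGroup G] {μ : Measure α} {f : α → E} {g : α → F}
    {h : α → G} (hf : AEStronglyMeasurable f μ) (hg : AEStronglyMeasurable g μ)
    (hh : AEStronglyMeasurable h μ) :
    ∫⁻ x, ‖f x‖ₑ * ‖g x‖ₑ * ‖h x‖ₑ ∂μ ≤
      eLpNorm f 2 μ ^ (1 / 2 : ℝ) * eLpNorm f 6 μ ^ (1 / 2 : ℝ) * eLpNorm g 2 μ
        * eLpNorm h 6 μ := by
  refine (lintegral_mul_mul_le hf.enorm hg.enorm hh.enorm).trans (le_of_eq ?_)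
  rw [eLpNorm_eq_lintegral_rpow_enorm_toReal (f := f) two_ne_zero ENNReal.ofNat_ne_top,
    eLpNorm_eq_lintegral_rpow_enorm_toReal (f := f) (p := 6) (by norm_num) ENNReal.ofNat_ne_top,
    eLpNorm_eq_lintegral_rpow_enorm_toReal (f := g) two_ne_zero ENNReal.ofNat_ne_top,
    eLpNorm_eq_lintegral_rpow_enorm_toReal (f := h) (p := 6) (by norm_num) ENNReal.ofNat_ne_top,
    ← ENNReal.rpow_mul, ← ENNReal.rpow_mul, ENNReal.toReal_ofNat, ENNReal.toReal_ofNat]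
  norm_num only

lemma lintegral_enorm_convIntegrand_le {C : ℝ≥0}
    (hC : ∀ v : X Ω, eLpNorm (vel v) 6 (volume.restrict Ω) ≤ C * ‖grad v‖ₑ) (w u v : X Ω) :
    ∫⁻ x in Ω, ‖convIntegrand (vel w x) (grad u x) (vel v x)‖ₑ ≤
      ‖vel w‖ₑ ^ (1 / 2 : ℝ) * (C * ‖grad w‖ₑ) ^ (1 / 2 : ℝ) * ‖grad u‖ₑ * (C * ‖grad v‖ₑ) := by
  calc ∫⁻ x in Ω, ‖convIntegrand (vel w x) (grad u x) (vel v x)‖ₑ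
      ≤ ∫⁻ x in Ω, ‖vel w x‖ₑ * ‖grad u x‖ₑ * ‖vel v x‖ₑ := by
        refine lintegral_mono fun x => ?_
        rw [Real.enorm_eq_ofReal_abs, ← ofReal_norm, ← ofReal_norm, ← ofReal_norm,
          ← ENNReal.ofReal_mul (norm_nonneg _), ← ENNReal.ofReal_mul (by positivity)]
        exact ENNReal.ofReal_le_ofReal (abs_convIntegrand_le _ _ _)
    _ ≤ _ := lintegral_enorm_mul_mul_le (Lp.aestronglyMeasurable _) (Lp.aestronglyMeasurable _)
        (Lp.aestronglyMeasurable _)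
    _ ≤ _ := by
        rw [← Lp.enorm_def, ← Lp.enorm_def]
        gcongr
        exacts [hC w, hC v]

lemma integrable_convIntegrand {C : ℝ≥0}
    (hC : ∀ v : X Ω, eLpNorm (vel v) 6 (volume.restrict Ω) ≤ C * ‖grad v‖ₑ) (w u v : X Ω) :
    IntegrableOn (fun x => convIntegrand (vel w x) (grad u x) (vel v x)) Ω :=
  ⟨aestronglyMeasurable_convIntegrand (Lp.aestronglyMeasurable _) (Lp.aestronglyMeasurable _)
    (Lp.aestronglyMeasurable _),
    (lintegral_enorm_convIntegrand_le hC w u v).trans_lt (by finiteness)⟩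

lemma abs_convForm_le {C : ℝ≥0}
    (hC : ∀ v : X Ω, eLpNorm (vel v) 6 (volume.restrict Ω) ≤ C * ‖grad v‖ₑ) (w u v : X Ω) :
    |convForm w u v| ≤ √C * C * √(‖vel w‖ * ‖grad w‖) * ‖grad u‖ * ‖grad v‖ := by
  have hle := ENNReal.toReal_mono (by finiteness) ((enorm_integral_le_lintegral_enorm _).trans
    (lintegral_enorm_convIntegrand_le hC w u v))
  simp only [← convForm_eq_integral, ENNReal.toReal_mul, toReal_enorm, ENNReal.coe_toReal,
    ← ENNReal.toReal_rpow, ← Real.sqrt_eq_rpow, Real.norm_eq_abs] at hle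
  rw [Real.sqrt_mul (norm_nonneg _)]
  rw [Real.sqrt_mul (NNReal.coe_nonneg C)] at hle
  linarith

/-- `L` is a common constant for the inequalities on `X` which the error analysis uses: Poincaré,
the bound of the divergence by the gradient, and the estimate of the convection form that is
interpolated between `L²` and `H¹` in its first argument. That the form is integrable belongs here
since `convForm` vanishes by convention where it is not. -/
structure IsFormBound (Ω : Set (Pt d)) (L : ℝ) : Prop where
  one_le : 1 ≤ L
  norm_vel_le : ∀ v : X Ω, ‖vel v‖ ≤ L * ‖grad v‖
  norm_divg_le : ∀ v : X Ω, ‖divg v‖ ≤ L * ‖grad v‖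
  integrable : ∀ w u v : X Ω,
    IntegrableOn (fun x => convIntegrand (vel w x) (grad u x) (vel v x)) Ω
  abs_convForm_le : ∀ w u v : X Ω,
    |convForm w u v| ≤ L * √(‖vel w‖ * ‖grad w‖) * ‖grad u‖ * ‖grad v‖

lemma exists_isFormBound (hd : d = 2 ∨ d = 3) (hΩ : Bornology.IsBounded Ω) :
    ∃ L, IsFormBound Ω L := by
  obtain ⟨C, hC⟩ := exists_eLpNorm_six_le hd hΩ
  obtain ⟨P, hP0, hP⟩ := exists_norm_vel_le hd hΩ
  let D := ‖matTrace (d := d)‖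
  have hC0 : 0 ≤ √(C : ℝ) * C := by positivity
  have hD0 : 0 ≤ D := norm_nonneg _
  refine ⟨1 + P + D + √C * C, by linarith, fun v => (hP v).trans ?_,
    fun v => (matTrace.norm_compLp_le (grad v)).trans ?_, integrable_convIntegrand hC,
    fun w u v => (abs_convForm_le hC w u v).trans ?_⟩
  all_goals gcongr; linarith

namespace IsFormBound

variable {L : ℝ}

lemma sqrt_norm_mul_norm_le (h : IsFormBound Ω L) (w : X Ω) :
    √(‖vel w‖ * ‖grad w‖) ≤ L * ‖grad w‖ := by
  have hL := h.one_le
  refine Real.sqrt_le_iff.mpr ⟨by positivity, ?_⟩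
  calc ‖vel w‖ * ‖grad w‖ ≤ L * ‖grad w‖ * ‖grad w‖ := by gcongr; exact h.norm_vel_le w
    _ ≤ (L * ‖grad w‖) ^ 2 := by nlinarith [sq_nonneg ‖grad w‖]

lemma abs_convForm_le_grad (h : IsFormBound Ω L) (w u v : X Ω) :
    |convForm w u v| ≤ L ^ 2 * ‖grad w‖ * ‖grad u‖ * ‖grad v‖ := by
  have hL := h.one_le
  calc |convForm w u v| ≤ L * (L * ‖grad w‖) * ‖grad u‖ * ‖grad v‖ := by
        refine (h.abs_convForm_le w u v).trans ?_
        gcongr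
        exact h.sqrt_norm_mul_norm_le w
    _ = _ := by ring

lemma abs_skewForm_le (h : IsFormBound Ω L) (w u v : X Ω) :
    |skewForm w u v| ≤ L * √(‖vel w‖ * ‖grad w‖) * ‖grad u‖ * ‖grad v‖ := by
  have huv := abs_le.mp (h.abs_convForm_le w u v)
  have hvu := abs_le.mp (h.abs_convForm_le w v u)
  rw [skewForm, abs_le]
  constructor <;> linarith [huv.1, huv.2, hvu.1, hvu.2]

lemma abs_skewForm_le_grad (h : IsFormBound Ω L) (w u v : X Ω) :
    |skewForm w u v| ≤ L ^ 2 * ‖grad w‖ * ‖grad u‖ * ‖grad v‖ := by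
  have huv := abs_le.mp (h.abs_convForm_le_grad w u v)
  have hvu := abs_le.mp (h.abs_convForm_le_grad w v u)
  rw [skewForm, abs_le]
  constructor <;> linarith [huv.1, huv.2, hvu.1, hvu.2]

lemma convForm_sub_left (h : IsFormBound Ω L) (w w' u v : X Ω) :
    convForm (w - w') u v = convForm w u v - convForm w' u v := by
  simp only [convForm_eq_integral]
  rw [← integral_sub (h.integrable w u v) (h.integrable w' u v)]
  refine integral_congr_ae ?_
  filter_upwards [Lp.coeFn_sub (vel w) (vel w')] with x hx
  rw [map_sub, hx]
  simp [convIntegrand, sub_mul, Finset.sum_sub_distrib]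

lemma convForm_sub_middle (h : IsFormBound Ω L) (w u u' v : X Ω) :
    convForm w (u - u') v = convForm w u v - convForm w u' v := by
  simp only [convForm_eq_integral]
  rw [← integral_sub (h.integrable w u v) (h.integrable w u' v)]
  refine integral_congr_ae ?_
  filter_upwards [Lp.coeFn_sub (grad u) (grad u')] with x hx
  rw [map_sub, hx]
  simp [convIntegrand, sub_mul, mul_sub, Finset.sum_sub_distrib]

lemma convForm_sub_right (h : IsFormBound Ω L) (w u v v' : X Ω) :
    convForm w u (v - v') = convForm w u v - convForm w u v' := by
  simp only [convForm_eq_integral]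
  rw [← integral_sub (h.integrable w u v) (h.integrable w u v')]
  refine integral_congr_ae ?_
  filter_upwards [Lp.coeFn_sub (vel v) (vel v')] with x hx
  rw [map_sub, hx]
  simp [convIntegrand, mul_sub, Finset.sum_sub_distrib]

lemma skewForm_sub_left (h : IsFormBound Ω L) (w w' u v : X Ω) :
    skewForm (w - w') u v = skewForm w u v - skewForm w' u v := by
  simp only [skewForm, h.convForm_sub_left]; ring

lemma skewForm_sub_middle (h : IsFormBound Ω L) (w u u' v : X Ω) :
    skewForm w (u - u') v = skewForm w u v - skewForm w u' v := by
  simp only [skewForm, h.convForm_sub_middle, h.convForm_sub_right]; ring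

lemma continuous_convForm (h : IsFormBound Ω L) :
    Continuous fun z : X Ω × X Ω × X Ω => convForm z.1 z.2.1 z.2.2 := by
  refine continuous_iff_continuousAt.mpr fun ⟨w₀, u₀, v₀⟩ => ?_
  refine tendsto_iff_norm_sub_tendsto_zero.mpr <| squeeze_zero (fun _ => norm_nonneg _)
    (g := fun z => L ^ 2 * ‖grad (z.1 - w₀)‖ * ‖grad z.2.1‖ * ‖grad z.2.2‖
      + L ^ 2 * ‖grad w₀‖ * ‖grad (z.2.1 - u₀)‖ * ‖grad z.2.2‖
      + L ^ 2 * ‖grad w₀‖ * ‖grad u₀‖ * ‖grad (z.2.2 - v₀)‖) (fun ⟨w, u, v⟩ => ?_) ?_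
  · have hsplit : convForm w u v - convForm w₀ u₀ v₀ = convForm (w - w₀) u v
        + convForm w₀ (u - u₀) v + convForm w₀ u₀ (v - v₀) := by
      rw [h.convForm_sub_left, h.convForm_sub_middle, h.convForm_sub_right]; ring
    rw [hsplit, Real.norm_eq_abs]
    exact (abs_add_three _ _ _).trans (by gcongr <;> exact h.abs_convForm_le_grad _ _ _)
  · refine Continuous.tendsto' ?_ _ _ (by simp)
    fun_prop

end IsFormBound

/-! ### Divergence-free fields -/

lemma divg_ae_eq (v : X Ω) : divg v =ᵐ[volume.restrict Ω] fun x => matTrace (grad v x) :=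
  (matTrace (d := d)).coeFn_compLpL (grad v)

lemma matTrace_apply (G : Mat d) : matTrace G = ∑ j, G (j, j) := by
  simp [matTrace]

lemma integral_mul_fderiv_eq_neg_of_hasCompactSupport {ρ θ : Pt d → ℝ} (hρ : ContDiff ℝ 1 ρ)
    (hρc : HasCompactSupport ρ) (hθ : ContDiff ℝ 1 θ) (y : Pt d) :
    ∫ x, ρ x * fderiv ℝ θ x y = -∫ x, fderiv ℝ ρ x y * θ x := by
  have hρ' : Continuous fun x => fderiv ℝ ρ x y :=
    (hρ.continuous_fderiv one_ne_zero).clm_apply continuous_const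
  have hθ' : Continuous fun x => fderiv ℝ θ x y :=
    (hθ.continuous_fderiv one_ne_zero).clm_apply continuous_const
  exact integral_mul_fderiv_eq_neg_fderiv_mul_of_integrable
    ((hρ'.mul hθ.continuous).integrable_of_hasCompactSupport
      (hρc.fderiv_apply (𝕜 := ℝ) y).mul_right)
    ((hρ.continuous.mul hθ').integrable_of_hasCompactSupport hρc.mul_right)
    ((hρ.continuous.mul hθ.continuous).integrable_of_hasCompactSupport hρc.mul_right)
    (fun x _ => hρ.differentiable one_ne_zero x) (fun x _ => hθ.differentiable one_ne_zero x)

lemma integral_fderiv_apply_of_hasCompactSupport {φ : Pt d → Pt d} (hφ : ContDiff ℝ 1 φ)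
    (hφc : HasCompactSupport φ) {θ : Pt d → ℝ} (hθ : ContDiff ℝ 1 θ) :
    ∫ x, fderiv ℝ θ x (φ x) = -∫ x, matTrace (jacobian φ x) * θ x := by
  let e : Fin d → Pt d := fun j => EuclideanSpace.single j 1
  let P : Fin d → Pt d →L[ℝ] ℝ := fun j => EuclideanSpace.proj j
  have hcoord : ∀ j, ContDiff ℝ 1 fun x => P j (φ x) := fun j => (P j).contDiff.comp hφ
  have hcoordc : ∀ j, HasCompactSupport fun x => P j (φ x) := fun j =>
    hφc.comp_left (map_zero (P j))
  have hjac : ∀ j x, fderiv ℝ (fun x => P j (φ x)) x (e j) = jacobian φ x (j, j) := fun j x => by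
    have hcomp := (P j).hasFDerivAt.comp x (hφ.differentiable one_ne_zero x).hasFDerivAt
    exact congrArg (fun D => D (e j)) hcomp.fderiv
  have hθe : ∀ j, Continuous fun x => fderiv ℝ θ x (e j) := fun j =>
    (hθ.continuous_fderiv one_ne_zero).clm_apply continuous_const
  have hexpand : ∀ x, fderiv ℝ θ x (φ x) = ∑ j, P j (φ x) * fderiv ℝ θ x (e j) := by
    intro x
    have hx : φ x = ∑ j, P j (φ x) • e j := by
      ext i
      simp [P, e, Pi.single_apply]
    conv_lhs => rw [hx]
    simp
  simp only [hexpand, matTrace_apply, Finset.sum_mul, ← hjac]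
  rw [integral_finsetSum, integral_finsetSum, ← Finset.sum_neg_distrib]
  · exact Finset.sum_congr rfl fun j _ =>
      integral_mul_fderiv_eq_neg_of_hasCompactSupport (hcoord j) (hcoordc j) hθ (e j)
  · exact fun j _ => ((((hcoord j).continuous_fderiv one_ne_zero).clm_apply
      continuous_const).mul hθ.continuous).integrable_of_hasCompactSupport
      ((hcoordc j).fderiv_apply (𝕜 := ℝ) (e j)).mul_right
  · exact fun j _ => ((hcoord j).continuous.mul (hθe j)).integrable_of_hasCompactSupport
      (hcoordc j).mul_right

lemma memLp_of_continuous {E : Type*} [NormedAddCommGroup E] (hΩo : IsOpen Ω)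
    (hΩb : Bornology.IsBounded Ω) {g : Pt d → E} (hg : Continuous g) (p : ℝ≥0∞) :
    MemLp g p (volume.restrict Ω) := by
  have : IsFiniteMeasure (volume.restrict Ω) := ⟨by simpa using hΩb.measure_lt_top⟩
  obtain ⟨C, hC⟩ := hΩb.isCompact_closure.exists_bound_of_continuousOn hg.continuousOn
  refine MemLp.of_bound hg.aestronglyMeasurable C ?_
  filter_upwards [ae_restrict_mem hΩo.measurableSet] with x hx
  exact hC x (subset_closure hx)

lemma integral_fderiv_apply_of_mem_testPairs {v : X Ω} (hv : (v : L2V Ω × L2M Ω) ∈ testPairs Ω)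
    {θ : Pt d → ℝ} (hθ : ContDiff ℝ 1 θ) :
    ∫ x in Ω, fderiv ℝ θ x (vel v x) = -∫ x in Ω, divg v x * θ x := by
  obtain ⟨φ, hφ, hφc, hφs, hvφ, hgφ⟩ := hv
  have hφ0 : ∀ x ∉ Ω, φ x = 0 := fun x hx => image_eq_zero_of_notMem_tsupport fun h => hx (hφs h)
  have hdφ0 : ∀ x ∉ Ω, fderiv ℝ φ x = 0 := fun x hx =>
    fderiv_of_notMem_tsupport ℝ fun h => hx (hφs h)
  have hleft : ∫ x in Ω, fderiv ℝ θ x (vel v x) = ∫ x, fderiv ℝ θ x (φ x) := by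
    refine Eq.trans (integral_congr_ae ?_) (setIntegral_eq_integral_of_forall_compl_eq_zero
      (s := Ω) fun x hx => by simp [hφ0 x hx])
    filter_upwards [hvφ] with x hx
    exact congrArg _ hx
  have hright : ∫ x in Ω, divg v x * θ x = ∫ x, matTrace (jacobian φ x) * θ x := by
    refine Eq.trans (integral_congr_ae ?_) (setIntegral_eq_integral_of_forall_compl_eq_zero
      (s := Ω) fun x hx => by simp [matTrace_apply, jacobian_apply, hdφ0 x hx])
    filter_upwards [hgφ, divg_ae_eq v] with x hx hdiv
    rw [hdiv]
    exact congrArg (fun G => matTrace G * θ x) hx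
  rw [hleft, hright]
  exact integral_fderiv_apply_of_hasCompactSupport (hφ.of_le (by simp)) hφc hθ

lemma integral_fderiv_apply_vel (hΩo : IsOpen Ω) (hΩb : Bornology.IsBounded Ω) {θ : Pt d → ℝ}
    (hθ : ContDiff ℝ 1 θ) (w : X Ω) :
    ∫ x in Ω, fderiv ℝ θ x (vel w x) = -∫ x in Ω, divg w x * θ x := by
  have hgrad : Continuous (gradient θ) :=
    (InnerProductSpace.toDual ℝ (Pt d)).symm.continuous.comp (hθ.continuous_fderiv one_ne_zero)
  have hgradLp := memLp_of_continuous hΩo hΩb hgrad 2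
  have hθLp := memLp_of_continuous hΩo hΩb hθ.continuous 2
  have hleft : ∀ v : X Ω,
      ∫ x in Ω, fderiv ℝ θ x (vel v x) = inner ℝ (hgradLp.toLp (gradient θ)) (vel v) := by
    intro v
    rw [L2.inner_def]
    refine integral_congr_ae ?_
    filter_upwards [hgradLp.coeFn_toLp] with x hx
    simp [hx, gradient]
  have hright : ∀ v : X Ω, ∫ x in Ω, divg v x * θ x = inner ℝ (hθLp.toLp θ) (divg v) := by
    intro v
    rw [L2.inner_def]
    refine integral_congr_ae ?_
    filter_upwards [hθLp.coeFn_toLp] with x hx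
    simp [hx]
  refine dense_testPairs.induction (fun v hv => integral_fderiv_apply_of_mem_testPairs hv hθ) ?_ w
  simp only [hleft, hright]
  exact isClosed_eq (by fun_prop) (by fun_prop)

lemma meanZero_divg (hΩo : IsOpen Ω) (hΩb : Bornology.IsBounded Ω) (w : X Ω) :
    MeanZero (divg w) := by
  simpa [MeanZero] using
    integral_fderiv_apply_vel hΩo hΩb (θ := fun _ => (1 : ℝ)) contDiff_const w

lemma convIntegrand_jacobian (φ : Pt d → Pt d) (x a b : Pt d) :
    convIntegrand a (jacobian φ x) b = inner ℝ (fderiv ℝ φ x a) b := by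
  simp [convIntegrand, PiLp.inner_apply, fderiv_apply_apply, Finset.mul_sum, mul_comm]

section Skew

variable {L : ℝ} {w : X Ω}

lemma convForm_skew_of_mem_testPairs (h : IsFormBound Ω L) (hΩo : IsOpen Ω)
    (hΩb : Bornology.IsBounded Ω) (hw : divg w = 0) {u v : X Ω}
    (hu : (u : L2V Ω × L2M Ω) ∈ testPairs Ω) (hv : (v : L2V Ω × L2M Ω) ∈ testPairs Ω) :
    convForm w u v = -convForm w v u := by
  obtain ⟨φ, hφ, -, -, huφ, hguφ⟩ := hu
  obtain ⟨χ, hχ, -, -, hvχ, hgvχ⟩ := hv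
  have hθ : ContDiff ℝ 1 fun x => inner ℝ (φ x) (χ x) := (hφ.inner ℝ hχ).of_le (by simp)
  have hdiv : ∫ x in Ω, divg w x * inner ℝ (φ x) (χ x) = 0 := by
    refine integral_eq_zero_of_ae ?_
    filter_upwards [Lp.coeFn_zero ℝ 2 (volume.restrict Ω)] with x hx
    rw [hw, hx, Pi.zero_apply, zero_mul]
  have hparts := integral_fderiv_apply_vel hΩo hΩb hθ w
  rw [hdiv, neg_zero] at hparts
  rw [eq_neg_iff_add_eq_zero, ← hparts, convForm_eq_integral, convForm_eq_integral,
    ← integral_add (h.integrable _ _ _) (h.integrable _ _ _)]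
  refine integral_congr_ae ?_
  filter_upwards [huφ, hguφ, hvχ, hgvχ] with x hu hgu hv hgv
  rw [show vel u x = φ x from hu, show grad u x = jacobian φ x from hgu,
    show vel v x = χ x from hv, show grad v x = jacobian χ x from hgv, convIntegrand_jacobian,
    convIntegrand_jacobian, fderiv_inner_apply ℝ (hφ.differentiable (by simp) x)
      (hχ.differentiable (by simp) x), real_inner_comm (φ x), add_comm]

lemma convForm_skew (h : IsFormBound Ω L) (hΩo : IsOpen Ω) (hΩb : Bornology.IsBounded Ω)
    (hw : divg w = 0) (u v : X Ω) : convForm w u v = -convForm w v u := by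
  have hcont := h.continuous_convForm
  have hclosed_left : ∀ v : X Ω, IsClosed {u : X Ω | convForm w u v = -convForm w v u} := fun v =>
    isClosed_eq (hcont.comp (f := fun u => (w, u, v)) (by fun_prop))
      (hcont.comp (f := fun u => (w, v, u)) (by fun_prop)).neg
  have hclosed_right : ∀ u : X Ω, IsClosed {v : X Ω | convForm w u v = -convForm w v u} := fun u =>
    isClosed_eq (hcont.comp (f := fun v => (w, u, v)) (by fun_prop))
      (hcont.comp (f := fun v => (w, v, u)) (by fun_prop)).neg
  refine dense_testPairs.induction (fun u hu => ?_) (hclosed_left v) u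
  exact dense_testPairs.induction
    (fun v hv => convForm_skew_of_mem_testPairs h hΩo hΩb hw hu hv) (hclosed_right u) v

lemma convForm_eq_skewForm (h : IsFormBound Ω L) (hΩo : IsOpen Ω) (hΩb : Bornology.IsBounded Ω)
    (hw : divg w = 0) (u v : X Ω) : convForm w u v = skewForm w u v := by
  rw [skewForm, convForm_skew h hΩo hΩb hw v u]
  ring

end Skew

lemma skewForm_self (w v : X Ω) : skewForm w v v = 0 := by
  rw [skewForm]; ring

/-! ### Primitives of vector-valued functions of time -/

section Primitive

variable {E F : Type*} [NormedAddCommGroup E] [NormedAddCommGroup F] {T a b : ℝ}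

lemma sq_intervalIntegral_le {f : ℝ → ℝ} (hab : a ≤ b) (hf : IntervalIntegrable f volume a b)
    (hf2 : IntervalIntegrable (fun s => f s ^ 2) volume a b) :
    (∫ s in a..b, f s) ^ 2 ≤ (b - a) * ∫ s in a..b, f s ^ 2 := by
  rcases hab.eq_or_lt with rfl | hlt
  · simp
  have : 0 < b - a := sub_pos.mpr hlt
  let c := (∫ s in a..b, f s) / (b - a)
  have htangent : ∫ s in a..b, (2 * c * f s - c ^ 2) ≤ ∫ s in a..b, f s ^ 2 :=
    intervalIntegral.integral_mono_on hab ((hf.const_mul _).sub intervalIntegrable_const) hf2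
      fun s _ => by linarith [sq_nonneg (f s - c)]
  rw [intervalIntegral.integral_sub (hf.const_mul _) intervalIntegrable_const,
    intervalIntegral.integral_const_mul, intervalIntegral.integral_const, smul_eq_mul] at htangent
  calc (∫ s in a..b, f s) ^ 2
      = (b - a) * (2 * c * (∫ s in a..b, f s) - (b - a) * c ^ 2) := by
        simp only [c]; field_simp; ring
    _ ≤ _ := by gcongr

lemma intervalIntegrable_of_integrableOn_Ioc {g : ℝ → E} (hg : IntegrableOn g (Ioc 0 T))
    (ha : 0 ≤ a) (hab : a ≤ b) (hb : b ≤ T) : IntervalIntegrable g volume a b :=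
  (intervalIntegrable_iff_integrableOn_Ioc_of_le hab).mpr (hg.mono_set (Ioc_subset_Ioc ha hb))

lemma sq_integral_norm_le {g : ℝ → E} (hg : MemLp g 2 (volume.restrict (Ioc 0 T))) (ha : 0 ≤ a)
    (hab : a ≤ b) (hb : b ≤ T) :
    (∫ s in a..b, ‖g s‖) ^ 2 ≤ (b - a) * ∫ s in a..b, ‖g s‖ ^ 2 :=
  sq_intervalIntegral_le hab
    (intervalIntegrable_of_integrableOn_Ioc (hg.integrable one_le_two).norm ha hab hb)
    (intervalIntegrable_of_integrableOn_Ioc (hg.integrable_norm_pow two_ne_zero) ha hab hb)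

variable [NormedSpace ℝ E] [NormedSpace ℝ F]

/-- `v` is absolutely continuous on `[0, T]` with Bochner derivative `g`: it is the representative
that is continuous in time of a member of `W^{1,1}(0, T; E)`. -/
structure IsPrimitiveOn (T : ℝ) (v g : ℝ → E) : Prop where
  integrableOn : IntegrableOn g (Ioc 0 T)
  eq_add_integral : ∀ t ∈ Icc 0 T, v t = v 0 + ∫ s in (0 : ℝ)..t, g s

namespace IsPrimitiveOn

variable {v w g : ℝ → E}

lemma intervalIntegrable (h : IsPrimitiveOn T v g) (ha : 0 ≤ a) (hab : a ≤ b) (hb : b ≤ T) :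
    IntervalIntegrable g volume a b :=
  intervalIntegrable_of_integrableOn_Ioc h.integrableOn ha hab hb

lemma sub_eq_integral (h : IsPrimitiveOn T v g) (ha : 0 ≤ a) (hab : a ≤ b) (hb : b ≤ T) :
    v b - v a = ∫ s in a..b, g s := by
  rw [h.eq_add_integral b ⟨ha.trans hab, hb⟩, h.eq_add_integral a ⟨ha, hab.trans hb⟩,
    add_sub_add_left_eq_sub]
  exact intervalIntegral.integral_interval_sub_left
    (h.intervalIntegrable le_rfl (ha.trans hab) hb) (h.intervalIntegrable le_rfl ha (hab.trans hb))

lemma continuousOn (h : IsPrimitiveOn T v g) (hT : 0 ≤ T) : ContinuousOn v (Icc 0 T) := by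
  have hcont := intervalIntegral.continuousOn_primitive_interval' (μ := volume) (a := 0)
    (h.intervalIntegrable le_rfl hT le_rfl) (by simp)
  rw [uIcc_of_le hT] at hcont
  exact (continuousOn_const.add hcont).congr h.eq_add_integral

lemma clm_comp [CompleteSpace E] [CompleteSpace F] (h : IsPrimitiveOn T v g) (A : E →L[ℝ] F) :
    IsPrimitiveOn T (fun t => A (v t)) (fun t => A (g t)) where
  integrableOn := A.integrable_comp h.integrableOn
  eq_add_integral t ht := by
    rw [h.eq_add_integral t ht, map_add,
      A.intervalIntegral_comp_comm (h.intervalIntegrable le_rfl ht.1 ht.2)]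

lemma norm_sub_le_integral (h : IsPrimitiveOn T v g) (ha : 0 ≤ a) (hab : a ≤ b) (hb : b ≤ T) :
    ‖v b - v a‖ ≤ ∫ s in a..b, ‖g s‖ := by
  rw [h.sub_eq_integral ha hab hb]
  exact intervalIntegral.norm_integral_le_integral_norm hab

lemma sq_norm_sub_le (h : IsPrimitiveOn T v g) (hg : MemLp g 2 (volume.restrict (Ioc 0 T)))
    (ha : 0 ≤ a) (hab : a ≤ b) (hb : b ≤ T) :
    ‖v b - v a‖ ^ 2 ≤ (b - a) * ∫ s in a..b, ‖g s‖ ^ 2 :=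
  (pow_le_pow_left₀ (norm_nonneg _) (h.norm_sub_le_integral ha hab hb) 2).trans
    (sq_integral_norm_le hg ha hab hb)

lemma norm_sub_le_mul_eLpNorm_top (h : IsPrimitiveOn T v g)
    (hg : MemLp g ⊤ (volume.restrict (Ioc 0 T))) (ha : 0 ≤ a) (hab : a ≤ b) (hb : b ≤ T) :
    ‖v b - v a‖ ≤ (b - a) * (eLpNorm g ⊤ (volume.restrict (Ioc 0 T))).toReal := by
  have hbound : ∀ᵐ t ∂(volume.restrict (Ioc 0 T)),
      ‖g t‖ ≤ (eLpNorm g ⊤ (volume.restrict (Ioc 0 T))).toReal := by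
    rw [eLpNorm_exponent_top]
    filter_upwards [ae_le_eLpNormEssSup (f := g) (μ := volume.restrict (Ioc 0 T))] with t ht
    simpa using ENNReal.toReal_mono (by simpa using hg.2.ne) ht
  rw [h.sub_eq_integral ha hab hb, mul_comm, ← abs_of_nonneg (sub_nonneg.mpr hab)]
  refine intervalIntegral.norm_integral_le_of_norm_le_const_ae ?_
  filter_upwards [(ae_restrict_iff' measurableSet_Ioc).mp hbound] with t ht hmem
  rw [uIoc_of_le hab] at hmem
  exact ht ⟨ha.trans_lt hmem.1, hmem.2.trans hb⟩

lemma norm_integral_sub_le (hw : IsPrimitiveOn T w g) (ha : 0 ≤ a)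
    (hab : a ≤ b) (hb : b ≤ T) :
    ‖∫ s in a..b, (w s - w b)‖ ≤ (∫ s in a..b, ‖g s‖) * |b - a| := by
  refine intervalIntegral.norm_integral_le_of_norm_le_const fun s hs => ?_
  rw [uIoc_of_le hab] at hs
  rw [norm_sub_rev]
  exact (hw.norm_sub_le_integral (ha.trans hs.1.le) hs.2 hb).trans <|
    intervalIntegral.integral_mono_interval hs.1.le hs.2 le_rfl
      (Filter.Eventually.of_forall fun _ => norm_nonneg _)
      (hw.intervalIntegrable ha hab hb).norm

lemma sq_norm_inv_smul_sub_sub_le [CompleteSpace E] (hv : IsPrimitiveOn T v w)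
    (hw : IsPrimitiveOn T w g) (hg : MemLp g 2 (volume.restrict (Ioc 0 T))) (ha : 0 ≤ a)
    (hab : a < b) (hb : b ≤ T) :
    ‖(b - a)⁻¹ • (v b - v a) - w b‖ ^ 2 ≤ (b - a) * ∫ s in a..b, ‖g s‖ ^ 2 := by
  have hba : 0 < b - a := sub_pos.mpr hab
  have hmean : (b - a)⁻¹ • (v b - v a) - w b = (b - a)⁻¹ • ∫ s in a..b, (w s - w b) := by
    rw [hv.sub_eq_integral ha hab.le hb,
      intervalIntegral.integral_sub (hv.intervalIntegrable ha hab.le hb) intervalIntegrable_const,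
      intervalIntegral.integral_const, smul_sub, smul_smul, inv_mul_cancel₀ hba.ne', one_smul]
  refine le_trans (pow_le_pow_left₀ (norm_nonneg _) ?_ 2) (sq_integral_norm_le hg ha hab.le hb)
  rw [hmean, norm_smul, Real.norm_of_nonneg (inv_nonneg.mpr hba.le), inv_mul_le_iff₀ hba,
    mul_comm (b - a)]
  simpa only [abs_of_pos hba] using norm_integral_sub_le hw ha hab.le hb

end IsPrimitiveOn

end Primitive

/-! ### The equations at the time nodes -/

namespace IsTimeRegular

variable {T : ℝ} {f : ℝ → L2V Ω} {u ut : ℝ → X Ω} {utt : ℝ → L2V Ω} {p pt : ℝ → L2S Ω}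

lemma isPrimitiveOn_u (h : IsTimeRegular Ω T f u ut utt p pt) : IsPrimitiveOn T u ut :=
  ⟨h.ut_mem.integrable one_le_two, h.u_eq⟩

lemma isPrimitiveOn_p (h : IsTimeRegular Ω T f u ut utt p pt) : IsPrimitiveOn T p pt :=
  ⟨h.pt_mem.integrable le_top, h.p_eq⟩

lemma exists_isPrimitiveOn_utt (h : IsTimeRegular Ω T f u ut utt p pt) :
    ∃ w, IsPrimitiveOn T w utt ∧ ∀ᵐ t ∂(volume.restrict (Ioc 0 T)), vel (ut t) = w t := by
  obtain ⟨a, ha⟩ := h.ut_eq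
  exact ⟨fun t => a + ∫ s in (0 : ℝ)..t, utt s,
    ⟨h.utt_mem.integrable one_le_two, fun t _ => by simp⟩, ha⟩

lemma isPrimitiveOn_vel (h : IsTimeRegular Ω T f u ut utt p pt) {w : ℝ → L2V Ω}
    (hw : ∀ᵐ t ∂(volume.restrict (Ioc 0 T)), vel (ut t) = w t) :
    IsPrimitiveOn T (fun t => vel (u t)) w where
  integrableOn := (h.isPrimitiveOn_u.clm_comp vel).integrableOn.congr hw
  eq_add_integral t ht := by
    rw [(h.isPrimitiveOn_u.clm_comp vel).eq_add_integral t ht,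
      intervalIntegral.integral_congr_ae]
    filter_upwards [(ae_restrict_iff' measurableSet_Ioc).mp hw] with s hs hmem
    rw [uIoc_of_le ht.1] at hmem
    exact hs (Ioc_subset_Ioc_right ht.2 hmem)

end IsTimeRegular

lemma eqOn_zero_of_ae_eq_zero {E : Type*} [NormedAddCommGroup E] {T : ℝ} (hT : 0 < T) {g : ℝ → E}
    (hg : ContinuousOn g (Icc 0 T)) (h : ∀ᵐ t ∂(volume.restrict (Ioc 0 T)), g t = 0) :
    EqOn g 0 (Icc 0 T) := by
  rw [restrict_Ioc_eq_restrict_Icc] at h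
  exact Measure.eqOn_Icc_of_ae_eq volume hT.ne h hg continuousOn_const

namespace IsWeakNSE

variable {ν T : ℝ} {f : ℝ → L2V Ω} {u₀ : X Ω} {u ut : ℝ → X Ω} {p : ℝ → L2S Ω}

lemma divg_eq_zero (h : IsWeakNSE Ω ν T f u₀ u ut p) (hΩo : IsOpen Ω)
    (hΩb : Bornology.IsBounded Ω) (hT : 0 < T) (hu : ContinuousOn u (Icc 0 T)) {t : ℝ}
    (ht : t ∈ Icc 0 T) : divg (u t) = 0 := by
  refine eqOn_zero_of_ae_eq_zero hT (divg.continuous.comp_continuousOn hu) ?_ ht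
  filter_upwards [h.continuity] with s hs
  exact inner_self_eq_zero.mp (hs _ (meanZero_divg hΩo hΩb _))

lemma momentum_at {L : ℝ} (hL : IsFormBound Ω L) (h : IsWeakNSE Ω ν T f u₀ u ut p) (hT : 0 < T)
    (hf : ContinuousOn f (Icc 0 T)) (hu : ContinuousOn u (Icc 0 T))
    (hp : ContinuousOn p (Icc 0 T)) {w : ℝ → L2V Ω} (hw : ContinuousOn w (Icc 0 T))
    (hutw : ∀ᵐ t ∂(volume.restrict (Ioc 0 T)), vel (ut t) = w t) {t : ℝ} (ht : t ∈ Icc 0 T)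
    (v : X Ω) :
    inner ℝ (w t) (vel v) + convForm (u t) (u t) v + ν * inner ℝ (grad (u t)) (grad v)
      - inner ℝ (p t) (divg v) = inner ℝ (f t) (vel v) := by
  rw [← sub_eq_zero]
  refine eqOn_zero_of_ae_eq_zero hT (g := fun t => inner ℝ (w t) (vel v) + convForm (u t) (u t) v
    + ν * inner ℝ (grad (u t)) (grad v) - inner ℝ (p t) (divg v) - inner ℝ (f t) (vel v))
    ?_ ?_ ht
  · have hconv : ContinuousOn (fun t => convForm (u t) (u t) v) (Icc 0 T) :=
      hL.continuous_convForm.comp_continuousOn (f := fun t => (u t, u t, v))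
        (hu.prodMk (hu.prodMk continuousOn_const))
    have hforce : ContinuousOn (fun t => inner ℝ (f t) (vel v)) (Icc 0 T) :=
      hf.inner continuousOn_const
    have haccel : ContinuousOn (fun t => inner ℝ (w t) (vel v)) (Icc 0 T) :=
      hw.inner continuousOn_const
    have hvisc : ContinuousOn (fun t => ν * inner ℝ (grad (u t)) (grad v)) (Icc 0 T) :=
      continuousOn_const.mul ((grad.continuous.comp_continuousOn hu).inner continuousOn_const)
    have hpres : ContinuousOn (fun t => inner ℝ (p t) (divg v)) (Icc 0 T) :=
      hp.inner continuousOn_const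
    exact (((haccel.add hconv).add hvisc).sub hpres).sub hforce
  · filter_upwards [h.momentum, hutw] with s hs hs'
    rw [← hs', hs v, sub_self]

end IsWeakNSE

/-- The weak Navier–Stokes equations at the time nodes `0, …, N`, in the form in which they are
compared with the scheme: `w n` is the time derivative of the velocity at the `n`-th node, and the
convection term is written with the skew-symmetric form. -/
structure IsSampledNSE (ν : ℝ) (N : ℕ) (f : ℕ → L2V Ω) (u : ℕ → X Ω) (w : ℕ → L2V Ω)
    (p : ℕ → L2S Ω) : Prop where
  momentum : ∀ n ≤ N, ∀ v : X Ω,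
    inner ℝ (w n) (vel v) + skewForm (u n) (u n) v + ν * inner ℝ (grad (u n)) (grad v)
      - inner ℝ (p n) (divg v) = inner ℝ (f n) (vel v)
  divg_eq_zero : ∀ n ≤ N, divg (u n) = 0

lemma IsWeakNSE.isSampledNSE {L ν T : ℝ} {f : ℝ → L2V Ω} {u₀ : X Ω} {u ut : ℝ → X Ω}
    {utt w : ℝ → L2V Ω} {p pt : ℝ → L2S Ω} (hL : IsFormBound Ω L) (hΩo : IsOpen Ω)
    (hΩb : Bornology.IsBounded Ω) (hT : 0 < T) (h : IsWeakNSE Ω ν T f u₀ u ut p)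
    (hreg : IsTimeRegular Ω T f u ut utt p pt) (hw : IsPrimitiveOn T w utt)
    (hutw : ∀ᵐ t ∂(volume.restrict (Ioc 0 T)), vel (ut t) = w t) {N : ℕ} {t : ℕ → ℝ}
    (ht : ∀ n ≤ N, t n ∈ Icc 0 T) :
    IsSampledNSE ν N (fun n => f (t n)) (fun n => u (t n)) (fun n => w (t n))
      (fun n => p (t n)) := by
  have hu := hreg.isPrimitiveOn_u.continuousOn hT.le
  have hdiv : ∀ n ≤ N, divg (u (t n)) = 0 := fun n hn => h.divg_eq_zero hΩo hΩb hT hu (ht n hn)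
  refine ⟨fun n hn v => ?_, hdiv⟩
  rw [← convForm_eq_skewForm hL hΩo hΩb (hdiv n hn)]
  exact h.momentum_at hL hT hreg.f_cont hu (hreg.isPrimitiveOn_p.continuousOn hT.le)
    (hw.continuousOn hT.le) hutw (ht n hn) v

lemma mul_mem_Icc_of_le {T Δt : ℝ} {N : ℕ} (hT : Δt * N = T) (hΔt : 0 ≤ Δt) {n : ℕ} (hn : n ≤ N) :
    n * Δt ∈ Icc 0 T := by
  refine ⟨by positivity, ?_⟩
  rw [← hT, mul_comm Δt]
  gcongr

lemma natCast_succ_mul_sub (n : ℕ) (x : ℝ) : ((n + 1 : ℕ) : ℝ) * x - n * x = x := by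
  push_cast; ring

lemma sum_integral_steps {T Δt : ℝ} {N : ℕ} {g : ℝ → ℝ} (hT : Δt * N = T) (hΔt : 0 ≤ Δt)
    (hg : IntegrableOn g (Ioc 0 T)) :
    ∑ n ∈ Finset.range N, ∫ s in n * Δt..(n + 1 : ℕ) * Δt, g s = ∫ s in (0 : ℝ)..T, g s := by
  have hsum := intervalIntegral.sum_integral_adjacent_intervals (μ := volume) (f := g)
    (a := fun n : ℕ => n * Δt) (n := N) fun k hk =>
      intervalIntegrable_of_integrableOn_Ioc hg (mul_mem_Icc_of_le hT hΔt hk.le).1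
        (by gcongr; simp) (mul_mem_Icc_of_le hT hΔt hk).2
  rw [hsum, Nat.cast_zero, zero_mul, mul_comm, hT]

section Nodes

variable {E : Type*} [NormedAddCommGroup E] [NormedSpace ℝ E] {T Δt : ℝ} {N : ℕ} {v w g : ℝ → E}

lemma sum_sq_norm_sub_le (hT : Δt * N = T) (hΔt : 0 ≤ Δt) (hv : IsPrimitiveOn T v g)
    (hg : MemLp g 2 (volume.restrict (Ioc 0 T))) :
    ∑ n ∈ Finset.range N, ‖v ((n + 1 : ℕ) * Δt) - v (n * Δt)‖ ^ 2
      ≤ Δt * ∫ t in (0 : ℝ)..T, ‖g t‖ ^ 2 := by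
  rw [← sum_integral_steps hT hΔt (hg.integrable_norm_pow two_ne_zero), Finset.mul_sum]
  refine Finset.sum_le_sum fun n hn => ?_
  have hn' := Finset.mem_range.mp hn
  simpa only [natCast_succ_mul_sub] using hv.sq_norm_sub_le hg (mul_mem_Icc_of_le hT hΔt hn'.le).1
    (by gcongr; simp) (mul_mem_Icc_of_le hT hΔt hn').2

lemma sum_sq_norm_inv_smul_sub_sub_le [CompleteSpace E] (hT : Δt * N = T) (hΔt : 0 < Δt)
    (hv : IsPrimitiveOn T v w) (hw : IsPrimitiveOn T w g)
    (hg : MemLp g 2 (volume.restrict (Ioc 0 T))) :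
    ∑ n ∈ Finset.range N,
        ‖Δt⁻¹ • (v ((n + 1 : ℕ) * Δt) - v (n * Δt)) - w ((n + 1 : ℕ) * Δt)‖ ^ 2
      ≤ Δt * ∫ t in (0 : ℝ)..T, ‖g t‖ ^ 2 := by
  rw [← sum_integral_steps hT hΔt.le (hg.integrable_norm_pow two_ne_zero), Finset.mul_sum]
  refine Finset.sum_le_sum fun n hn => ?_
  have hn' := Finset.mem_range.mp hn
  simpa only [natCast_succ_mul_sub] using hv.sq_norm_inv_smul_sub_sub_le hw hg
    (mul_mem_Icc_of_le hT hΔt.le hn'.le).1 (by gcongr; simp) (mul_mem_Icc_of_le hT hΔt.le hn').2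

lemma norm_step_sub_le (hT : Δt * N = T) (hΔt : 0 ≤ Δt) (hv : IsPrimitiveOn T v g)
    (hg : MemLp g ⊤ (volume.restrict (Ioc 0 T))) {n : ℕ} (hn : n < N) :
    ‖v ((n + 1 : ℕ) * Δt) - v (n * Δt)‖
      ≤ Δt * (eLpNorm g ⊤ (volume.restrict (Ioc 0 T))).toReal := by
  simpa only [natCast_succ_mul_sub] using hv.norm_sub_le_mul_eLpNorm_top hg
    (mul_mem_Icc_of_le hT hΔt hn.le).1 (by gcongr; simp) (mul_mem_Icc_of_le hT hΔt hn).2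

end Nodes

namespace IsTimeRegular

variable {T Δt : ℝ} {N : ℕ} {f : ℝ → L2V Ω} {u ut : ℝ → X Ω} {utt w : ℝ → L2V Ω}
  {p pt : ℝ → L2S Ω}

lemma sum_sq_norm_grad_sub_le (h : IsTimeRegular Ω T f u ut utt p pt) (hT : Δt * N = T)
    (hΔt : 0 ≤ Δt) :
    ∑ n ∈ Finset.range N, ‖grad (u ((n + 1 : ℕ) * Δt) - u (n * Δt))‖ ^ 2
      ≤ Δt * ∫ t in (0 : ℝ)..T, ‖grad (ut t)‖ ^ 2 := by
  simpa only [map_sub] using sum_sq_norm_sub_le hT hΔt (h.isPrimitiveOn_u.clm_comp grad)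
    (grad.comp_memLp' h.ut_mem)

end IsTimeRegular

/-! ### The discrete Gronwall inequality and stability of the scheme -/

lemma add_sum_le_one_add_pow_mul {S D F : ℕ → ℝ} {a : ℝ} (ha : 0 ≤ a)
    (hD : ∀ n, 0 ≤ D n) (hF : ∀ n, 0 ≤ F n) {N : ℕ}
    (h : ∀ n < N, S (n + 1) + D n ≤ (1 + a) * S n + F n) :
    S N + ∑ n ∈ Finset.range N, D n ≤ (1 + a) ^ N * (S 0 + ∑ n ∈ Finset.range N, F n) := by
  induction N with
  | zero => simp
  | succ N ih =>
    have hih := ih fun n hn => h n (by omega)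
    have hstep := h N (by omega)
    have hsum : 0 ≤ a * ∑ n ∈ Finset.range N, D n :=
      mul_nonneg ha (Finset.sum_nonneg fun n _ => hD n)
    have hpow : F N ≤ (1 + a) ^ (N + 1) * F N :=
      le_mul_of_one_le_left (hF N) (one_le_pow₀ (by linarith))
    rw [Finset.sum_range_succ, Finset.sum_range_succ]
    calc S (N + 1) + (∑ n ∈ Finset.range N, D n + D N)
        ≤ (1 + a) * (S N + ∑ n ∈ Finset.range N, D n) + F N := by linarith
      _ ≤ (1 + a) * ((1 + a) ^ N * (S 0 + ∑ n ∈ Finset.range N, F n))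
          + (1 + a) ^ (N + 1) * F N := by gcongr
      _ = _ := by ring

lemma discrete_gronwall {S D F : ℕ → ℝ} {a : ℝ} (ha : 0 ≤ a) (hS : 0 ≤ S 0) (hD : ∀ n, 0 ≤ D n)
    (hF : ∀ n, 0 ≤ F n) {N : ℕ} (h : ∀ n < N, S (n + 1) + D n ≤ (1 + a) * S n + F n) :
    S N + ∑ n ∈ Finset.range N, D n ≤
      Real.exp (N * a) * (S 0 + ∑ n ∈ Finset.range N, F n) := by
  refine (add_sum_le_one_add_pow_mul ha hD hF h).trans ?_
  have hsum : 0 ≤ S 0 + ∑ n ∈ Finset.range N, F n :=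
    add_nonneg hS (Finset.sum_nonneg fun n _ => hF n)
  rw [Real.exp_nat_mul]
  gcongr
  linarith [Real.add_one_le_exp a]

lemma two_inner_sub_self {H : Type*} [NormedAddCommGroup H] [InnerProductSpace ℝ H] (x y : H) :
    2 * inner ℝ (x - y) x = ‖x‖ ^ 2 - ‖y‖ ^ 2 + ‖x - y‖ ^ 2 := by
  rw [norm_sub_sq_real, inner_sub_left, real_inner_self_eq_norm_sq, real_inner_comm]
  ring

lemma IsFormBound.inner_le_negNorm {L : ℝ} (h : IsFormBound Ω L) (g : L2V Ω) (v : X Ω) :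
    inner ℝ g (vel v) ≤ negNorm g * ‖grad v‖ := by
  have hL := h.one_le
  have hbound : ∀ w : X Ω, inner ℝ g (vel w) ≤ ‖g‖ * L * ‖grad w‖ := fun w =>
    calc inner ℝ g (vel w) ≤ ‖g‖ * ‖vel w‖ := real_inner_le_norm _ _
      _ ≤ ‖g‖ * (L * ‖grad w‖) := by gcongr; exact h.norm_vel_le w
      _ = _ := by ring
  rcases (norm_nonneg (grad v)).eq_or_lt with hv | hv
  · simpa [← hv] using hbound v
  · rw [← div_le_iff₀ hv]
    refine le_ciSup (f := fun w : X Ω => inner ℝ g (vel w) / ‖grad w‖) ⟨‖g‖ * L, ?_⟩ v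
    rintro _ ⟨w, rfl⟩
    exact div_le_of_le_mul₀ (norm_nonneg _) (by positivity) (hbound w)

namespace IsACROM

variable {XR : Submodule ℝ (X Ω)} {QM : Submodule ℝ (L2S Ω)} {ν ε Δt L : ℝ} {N : ℕ}
  {f : ℕ → L2V Ω} {uR : ℕ → X Ω} {pM : ℕ → L2S Ω}

lemma energy_identity (h : IsACROM XR QM ν ε Δt N f uR pM) (hΔt : Δt ≠ 0) {n : ℕ} (hn : n < N) :
    inner ℝ (vel (uR (n + 1)) - vel (uR n)) (vel (uR (n + 1)))
        + ε * inner ℝ (pM (n + 1) - pM n) (pM (n + 1)) + ν * Δt * ‖grad (uR (n + 1))‖ ^ 2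
      = Δt * inner ℝ (f (n + 1)) (vel (uR (n + 1))) := by
  have hv := h.velocity n hn _ (h.mem_XR (n + 1) hn)
  have hp := h.pressure n hn _ (h.mem_QM (n + 1) hn)
  rw [skewForm_self, real_inner_smul_left, real_inner_self_eq_norm_sq] at hv
  rw [real_inner_smul_left, real_inner_comm (pM (n + 1)) (divg (uR (n + 1)))] at hp
  field_simp at hv hp
  linear_combination hv + hp

lemma energy_step (h : IsACROM XR QM ν ε Δt N f uR pM) (hL : IsFormBound Ω L) (hν : 0 < ν)
    (hε : 0 ≤ ε) (hΔt : 0 < Δt) {n : ℕ} (hn : n < N) :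
    ‖vel (uR (n + 1))‖ ^ 2 + ε * ‖pM (n + 1)‖ ^ 2 + ν * Δt * ‖grad (uR (n + 1))‖ ^ 2
      ≤ ‖vel (uR n)‖ ^ 2 + ε * ‖pM n‖ ^ 2 + Δt / ν * negNorm (f (n + 1)) ^ 2 := by
  have hid := h.energy_identity hΔt.ne' hn
  have hforce : Δt * inner ℝ (f (n + 1)) (vel (uR (n + 1)))
      ≤ Δt * (negNorm (f (n + 1)) * ‖grad (uR (n + 1))‖) := by
    gcongr
    exact hL.inner_le_negNorm _ _
  have hyoung : Δt * (2 * ‖grad (uR (n + 1))‖ * negNorm (f (n + 1)))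
      ≤ Δt * (ν * ‖grad (uR (n + 1))‖ ^ 2 + ν⁻¹ * negNorm (f (n + 1)) ^ 2) := by
    gcongr
    exact two_mul_le_add_mul_sq hν
  have hvel := two_inner_sub_self (vel (uR (n + 1))) (vel (uR n))
  have hpres := congrArg (ε * ·) (two_inner_sub_self (pM (n + 1)) (pM n))
  have hjump : 0 ≤ ε * ‖pM (n + 1) - pM n‖ ^ 2 := by positivity
  rw [div_eq_mul_inv]
  linarith [sq_nonneg ‖vel (uR (n + 1)) - vel (uR n)‖]

lemma energy_le (h : IsACROM XR QM ν ε Δt N f uR pM) (hL : IsFormBound Ω L) (hν : 0 < ν)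
    (hε : 0 ≤ ε) (hΔt : 0 < Δt) {n : ℕ} (hn : n ≤ N) :
    ‖vel (uR n)‖ ^ 2 + ε * ‖pM n‖ ^ 2 + ∑ k ∈ Finset.range n, ν * Δt * ‖grad (uR (k + 1))‖ ^ 2
      ≤ ‖vel (uR 0)‖ ^ 2 + ε * ‖pM 0‖ ^ 2
        + 4 * Δt / ν * ∑ k ∈ Finset.range N, negNorm (f (k + 1)) ^ 2 := by
  have hgron := add_sum_le_one_add_pow_mul (N := n) (a := 0)
    (S := fun k => ‖vel (uR k)‖ ^ 2 + ε * ‖pM k‖ ^ 2)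
    (D := fun k => ν * Δt * ‖grad (uR (k + 1))‖ ^ 2)
    (F := fun k => Δt / ν * negNorm (f (k + 1)) ^ 2) le_rfl
    (fun _ => by positivity) (fun _ => by positivity)
    fun k hk => by simpa using h.energy_step hL hν hε hΔt (hk.trans_le hn)
  rw [add_zero, one_pow, one_mul, ← Finset.mul_sum _ _ (Δt / ν)] at hgron
  refine hgron.trans ?_
  have hsum : ∑ k ∈ Finset.range n, negNorm (f (k + 1)) ^ 2
      ≤ ∑ k ∈ Finset.range N, negNorm (f (k + 1)) ^ 2 :=
    Finset.sum_le_sum_of_subset_of_nonneg (Finset.range_mono hn) fun _ _ _ => sq_nonneg _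
  gcongr
  linarith

lemma sq_norm_vel_le (h : IsACROM XR QM ν ε Δt N f uR pM) (hL : IsFormBound Ω L) (hν : 0 < ν)
    (hε : 0 ≤ ε) (hΔt : 0 < Δt) {K : ℝ}
    (hK : ‖vel (uR 0)‖ ^ 2 + ν * Δt * ‖grad (uR 0)‖ ^ 2 + ε * ‖pM 0‖ ^ 2
        + 4 * Δt / ν * ∑ n ∈ Finset.range N, negNorm (f (n + 1)) ^ 2 ≤ K) {n : ℕ} (hn : n ≤ N) :
    ‖vel (uR n)‖ ^ 2 ≤ K := by
  have hE := h.energy_le hL hν hε hΔt hn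
  have hpres : 0 ≤ ε * ‖pM n‖ ^ 2 := by positivity
  have hdiss : 0 ≤ ∑ k ∈ Finset.range n, ν * Δt * ‖grad (uR (k + 1))‖ ^ 2 := by positivity
  have hgrad : 0 ≤ ν * Δt * ‖grad (uR 0)‖ ^ 2 := by positivity
  linarith

lemma sum_sq_norm_grad_le (h : IsACROM XR QM ν ε Δt N f uR pM) (hL : IsFormBound Ω L)
    (hν : 0 < ν) (hε : 0 ≤ ε) (hΔt : 0 < Δt) {K : ℝ}
    (hK : ‖vel (uR 0)‖ ^ 2 + ν * Δt * ‖grad (uR 0)‖ ^ 2 + ε * ‖pM 0‖ ^ 2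
        + 4 * Δt / ν * ∑ n ∈ Finset.range N, negNorm (f (n + 1)) ^ 2 ≤ K) :
    ν * Δt * ∑ n ∈ Finset.range N, ‖grad (uR n)‖ ^ 2 ≤ K := by
  have hE := h.energy_le hL hν hε hΔt le_rfl
  have hpres : 0 ≤ ε * ‖pM N‖ ^ 2 := by positivity
  have hlast : 0 ≤ ν * Δt * ‖grad (uR N)‖ ^ 2 := by positivity
  have hshift := Finset.sum_range_succ' (fun n => ν * Δt * ‖grad (uR n)‖ ^ 2) N
  rw [Finset.sum_range_succ] at hshift
  rw [Finset.mul_sum]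
  linarith [sq_nonneg ‖vel (uR N)‖]

end IsACROM

/-! ### Projections and principal angles -/

section Angle

variable {H : Type*} [NormedAddCommGroup H] [InnerProductSpace ℝ H] {A B : Submodule ℝ H}

lemma bddBelow_arccos (A B : Submodule ℝ H) :
    BddBelow {θ | ∃ v ∈ A, ∃ ψ ∈ B, θ = Real.arccos (|inner ℝ v ψ| / (‖v‖ * ‖ψ‖))} := by
  refine ⟨0, ?_⟩
  rintro θ ⟨v, _, ψ, _, rfl⟩
  exact Real.arccos_nonneg _

lemma firstPrincipalAngle_nonneg (A B : Submodule ℝ H) : 0 ≤ firstPrincipalAngle A B := by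
  refine Real.sInf_nonneg ?_
  rintro θ ⟨v, _, ψ, _, rfl⟩
  exact Real.arccos_nonneg _

lemma firstPrincipalAngle_le_arccos {v ψ : H} (hv : v ∈ A) (hψ : ψ ∈ B) :
    firstPrincipalAngle A B ≤ Real.arccos (|inner ℝ v ψ| / (‖v‖ * ‖ψ‖)) :=
  csInf_le (bddBelow_arccos A B) ⟨v, hv, ψ, hψ, rfl⟩

lemma cos_firstPrincipalAngle_nonneg (A B : Submodule ℝ H) :
    0 ≤ Real.cos (firstPrincipalAngle A B) :=
  Real.cos_nonneg_of_neg_pi_div_two_le_of_le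
    (by linarith [firstPrincipalAngle_nonneg A B, Real.pi_pos])
    (by simpa using firstPrincipalAngle_le_arccos (zero_mem A) (zero_mem B))

lemma abs_inner_le_cos_firstPrincipalAngle {v ψ : H} (hv : v ∈ A) (hψ : ψ ∈ B) :
    |inner ℝ v ψ| ≤ Real.cos (firstPrincipalAngle A B) * (‖v‖ * ‖ψ‖) := by
  have hratio0 : 0 ≤ |inner ℝ v ψ| / (‖v‖ * ‖ψ‖) := by positivity
  have hratio1 : |inner ℝ v ψ| / (‖v‖ * ‖ψ‖) ≤ 1 :=
    div_le_one_of_le₀ (abs_real_inner_le_norm v ψ) (by positivity)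
  have hcos := Real.cos_le_cos_of_nonneg_of_le_pi (firstPrincipalAngle_nonneg A B)
    (Real.arccos_le_pi _) (firstPrincipalAngle_le_arccos hv hψ)
  rw [Real.cos_arccos (by linarith) hratio1] at hcos
  rcases (by positivity : 0 ≤ ‖v‖ * ‖ψ‖).eq_or_lt with h | h
  · have hle := abs_real_inner_le_norm v ψ
    rw [← h] at hle ⊢
    simpa using hle
  · rwa [div_le_iff₀ h] at hcos

end Angle

lemma velProj_mem {R : ℕ} (φ : Fin R → X Ω) (v : X Ω) :
    velProj φ v ∈ Submodule.span ℝ (range φ) :=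
  Submodule.sum_mem _ fun i _ => Submodule.smul_mem _ _ (Submodule.subset_span ⟨i, rfl⟩)

lemma presProj_mem {M : ℕ} (ψ : Fin M → L2S Ω) (q : L2S Ω) :
    presProj ψ q ∈ Submodule.span ℝ (range ψ) :=
  Submodule.sum_mem _ fun i _ => Submodule.smul_mem _ _ (Submodule.subset_span ⟨i, rfl⟩)

lemma divg_velProj_mem {R : ℕ} (φ : Fin R → X Ω) (v : X Ω) :
    divg (velProj φ v) ∈ Submodule.span ℝ (range fun i => divg (φ i)) := by
  simp only [velProj, map_sum, map_smul]
  exact Submodule.sum_mem _ fun i _ => Submodule.smul_mem _ _ (Submodule.subset_span ⟨i, rfl⟩)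

lemma angleCos_nonneg {R M : ℕ} (φ : Fin R → X Ω) (ψ : Fin M → L2S Ω) : 0 ≤ angleCos φ ψ :=
  cos_firstPrincipalAngle_nonneg _ _

lemma abs_inner_divg_le_angleCos {R M : ℕ} (φ : Fin R → X Ω) (ψ : Fin M → L2S Ω) {u : X Ω}
    (hu : divg u = 0) {q : L2S Ω} (hq : q ∈ Submodule.span ℝ (range ψ)) :
    |inner ℝ (divg (u - velProj φ u)) q|
      ≤ angleCos φ ψ * (‖divg (u - velProj φ u)‖ * ‖q‖) := by
  refine abs_inner_le_cos_firstPrincipalAngle ?_ hq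
  rw [map_sub, hu, zero_sub]
  exact Submodule.neg_mem _ (divg_velProj_mem φ u)

/-! ### The error recursion -/

/-- The splitting `u - u_R = η - ξ`, `p - p_M = κ - π` of the velocity and pressure errors at the
time nodes `0, …, N` into `L²` projection errors `η`, `κ`, orthogonal to the reduced spaces, and
discrete errors `ξ`, `π`, lying in the reduced spaces. -/
structure IsErrorSplitting (XR : Submodule ℝ (X Ω)) (QM : Submodule ℝ (L2S Ω)) (N : ℕ)
    (u uR η ξ : ℕ → X Ω) (p pM κ π : ℕ → L2S Ω) : Prop where
  sub_uR : ∀ n, u n - uR n = η n - ξ n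
  sub_pM : ∀ n, p n - pM n = κ n - π n
  mem_XR : ∀ n ≤ N, ξ n ∈ XR
  mem_QM : ∀ n ≤ N, π n ∈ QM
  inner_vel : ∀ n, ∀ v ∈ XR, inner ℝ (vel (η n)) (vel v) = 0
  inner_pres : ∀ n, ∀ q ∈ QM, inner ℝ (κ n) q = 0

/-- The truncation error of the implicit Euler step from node `n` to node `n + 1`. -/
def truncErr (Δt : ℝ) (u : ℕ → X Ω) (w : ℕ → L2V Ω) (n : ℕ) : L2V Ω :=
  Δt⁻¹ • (vel (u (n + 1)) - vel (u n)) - w (n + 1)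

lemma IsTimeRegular.sum_sq_norm_truncErr_le {T Δt : ℝ} {N : ℕ} {f : ℝ → L2V Ω} {u ut : ℝ → X Ω}
    {utt w : ℝ → L2V Ω} {p pt : ℝ → L2S Ω} (h : IsTimeRegular Ω T f u ut utt p pt)
    (hw : IsPrimitiveOn T w utt) (hutw : ∀ᵐ t ∂(volume.restrict (Ioc 0 T)), vel (ut t) = w t)
    (hT : Δt * N = T) (hΔt : 0 < Δt) :
    ∑ n ∈ Finset.range N, ‖truncErr Δt (fun n => u (n * Δt)) (fun n => w (n * Δt)) n‖ ^ 2
      ≤ Δt * ∫ t in (0 : ℝ)..T, ‖utt t‖ ^ 2 := by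
  simp only [truncErr]
  exact sum_sq_norm_inv_smul_sub_sub_le (v := fun t => vel (u t)) hT hΔt
    (h.isPrimitiveOn_vel hutw) hw h.utt_mem

/-- The right-hand side, tested with `v`, of the momentum equation for the discrete error `ξ` in
the step from node `n` to node `n + 1`. -/
def errResidual (ν Δt : ℝ) (u : ℕ → X Ω) (w : ℕ → L2V Ω) (uR η ξ : ℕ → X Ω) (κ : ℕ → L2S Ω)
    (n : ℕ) (v : X Ω) : ℝ :=
  -inner ℝ (truncErr Δt u w n) (vel v) + ν * inner ℝ (grad (η (n + 1))) (grad v)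
    - inner ℝ (κ (n + 1)) (divg v) - skewForm (ξ n) (u (n + 1)) v
    + skewForm (η n) (u (n + 1)) v + skewForm (u (n + 1) - u n) (u (n + 1)) v
    + skewForm (uR n) (η (n + 1)) v

/-- The square of the momentum consistency error, up to constants, in the step from node `n` to
node `n + 1`. -/
def consistencySq (Δt : ℝ) (u : ℕ → X Ω) (w : ℕ → L2V Ω) (uR η : ℕ → X Ω) (κ : ℕ → L2S Ω)
    (n : ℕ) : ℝ :=
  ‖truncErr Δt u w n‖ ^ 2 + ‖grad (η (n + 1))‖ ^ 2 + ‖κ (n + 1)‖ ^ 2 + ‖grad (η n)‖ ^ 2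
    + ‖grad (u (n + 1) - u n)‖ ^ 2
    + ‖vel (uR n)‖ * ‖grad (uR n)‖ * ‖grad (η (n + 1))‖ ^ 2

lemma consistencySq_nonneg (Δt : ℝ) (u : ℕ → X Ω) (w : ℕ → L2V Ω) (uR η : ℕ → X Ω)
    (κ : ℕ → L2S Ω) (n : ℕ) : 0 ≤ consistencySq Δt u w uR η κ n := by
  rw [consistencySq]; positivity

lemma sq_sum_seven_le (a b c d e f g : ℝ) :
    (a + b + c + d + e + f + g) ^ 2
      ≤ 7 * (a ^ 2 + b ^ 2 + c ^ 2 + d ^ 2 + e ^ 2 + f ^ 2 + g ^ 2) := by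
  simpa [Fin.sum_univ_succ, add_assoc] using
    sq_sum_le_card_mul_sum_sq (s := Finset.univ) (f := ![a, b, c, d, e, f, g])

lemma IsFormBound.skewForm_sub_skewForm {L : ℝ} (h : IsFormBound Ω L) (w w' u u' v : X Ω) :
    skewForm w u v - skewForm w' u' v = skewForm (w - w') u v + skewForm w' (u - u') v := by
  rw [h.skewForm_sub_left, h.skewForm_sub_middle]; ring

section Residual

variable {ν Δt K L : ℝ} {u uR η ξ : ℕ → X Ω} {w : ℕ → L2V Ω} {κ : ℕ → L2S Ω} {n : ℕ}

lemma errResidual_le (hL : IsFormBound Ω L) (hν : 0 ≤ ν) (hK : ‖grad (u (n + 1))‖ ≤ K)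
    (v : X Ω) :
    errResidual ν Δt u w uR η ξ κ n v
      ≤ (L * ‖truncErr Δt u w n‖ + ν * ‖grad (η (n + 1))‖ + L * ‖κ (n + 1)‖
        + L * √(‖vel (ξ n)‖ * ‖grad (ξ n)‖) * K + L ^ 2 * ‖grad (η n)‖ * K
        + L ^ 2 * ‖grad (u (n + 1) - u n)‖ * K
        + L * √(‖vel (uR n)‖ * ‖grad (uR n)‖) * ‖grad (η (n + 1))‖) * ‖grad v‖ := by
  have hL0 : 0 ≤ L := zero_le_one.trans hL.one_le
  have htrunc : -inner ℝ (truncErr Δt u w n) (vel v) ≤ ‖truncErr Δt u w n‖ * (L * ‖grad v‖) :=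
    (neg_le_abs _).trans <| (abs_real_inner_le_norm _ _).trans <| by
      gcongr; exact hL.norm_vel_le v
  have hvisc : ν * inner ℝ (grad (η (n + 1))) (grad v) ≤ ν * (‖grad (η (n + 1))‖ * ‖grad v‖) := by
    gcongr; exact real_inner_le_norm _ _
  have hpres : -inner ℝ (κ (n + 1)) (divg v) ≤ ‖κ (n + 1)‖ * (L * ‖grad v‖) :=
    (neg_le_abs _).trans <| (abs_real_inner_le_norm _ _).trans <| by
      gcongr; exact hL.norm_divg_le v
  have hξ : -skewForm (ξ n) (u (n + 1)) v ≤ L * √(‖vel (ξ n)‖ * ‖grad (ξ n)‖) * K * ‖grad v‖ :=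
    (neg_le_abs _).trans <| (hL.abs_skewForm_le _ _ _).trans <| by gcongr
  have hη : skewForm (η n) (u (n + 1)) v ≤ L ^ 2 * ‖grad (η n)‖ * K * ‖grad v‖ :=
    (le_abs_self _).trans <| (hL.abs_skewForm_le_grad _ _ _).trans <| by gcongr
  have hδ : skewForm (u (n + 1) - u n) (u (n + 1)) v
      ≤ L ^ 2 * ‖grad (u (n + 1) - u n)‖ * K * ‖grad v‖ :=
    (le_abs_self _).trans <| (hL.abs_skewForm_le_grad _ _ _).trans <| by gcongr
  have huR := (le_abs_self _).trans (hL.abs_skewForm_le (uR n) (η (n + 1)) v)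
  rw [errResidual]
  linarith

lemma sq_convection_coeff_le {x y : ℝ} (hν : 0 < ν) (hx : 0 ≤ x) (hy : 0 ≤ y) :
    7 / ν * (L * √(x * y) * K) ^ 2 ≤ ν / 2 * y ^ 2 + 49 / 2 * L ^ 4 * K ^ 4 / ν ^ 3 * x ^ 2 := by
  have hyoung := two_mul_le_add_mul_sq (a := y) (b := 7 / (2 * ν) * L ^ 2 * K ^ 2 * x)
    (half_pos hν)
  rw [mul_pow, mul_pow, Real.sq_sqrt (by positivity)]
  calc 7 / ν * (L ^ 2 * (x * y) * K ^ 2) = 2 * y * (7 / (2 * ν) * L ^ 2 * K ^ 2 * x) := by ring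
    _ ≤ _ := hyoung
    _ = _ := by field_simp; ring

lemma sq_residual_coeff_le {ν₀ s τ h h' k δ r : ℝ} (hL : 1 ≤ L) (hν : 0 ≤ ν) (hν₀ : ν ≤ ν₀)
    (hr : 0 ≤ r) :
    (L * τ + ν * h' + L * k + s + L ^ 2 * h * K + L ^ 2 * δ * K + L * √r * h') ^ 2
      ≤ 7 * s ^ 2 + 7 * (ν₀ ^ 2 + L ^ 4 * (1 + K ^ 2))
        * (τ ^ 2 + h' ^ 2 + k ^ 2 + h ^ 2 + δ ^ 2 + r * h' ^ 2) := by
  set c := ν₀ ^ 2 + L ^ 4 * (1 + K ^ 2)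
  have hL2 : L ^ 2 ≤ c := by
    have hpow : L ^ 2 ≤ L ^ 4 := pow_le_pow_right₀ hL (by norm_num)
    linarith [sq_nonneg ν₀, sq_nonneg (L ^ 2 * K)]
  have hL4 : L ^ 4 * K ^ 2 ≤ c := by linarith [sq_nonneg ν₀, sq_nonneg (L ^ 2)]
  have hν2 : ν ^ 2 ≤ c :=
    (pow_le_pow_left₀ hν hν₀ 2).trans (le_add_of_nonneg_right (by positivity))
  calc _ ≤ 7 * ((L * τ) ^ 2 + (ν * h') ^ 2 + (L * k) ^ 2 + s ^ 2 + (L ^ 2 * h * K) ^ 2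
          + (L ^ 2 * δ * K) ^ 2 + (L * √r * h') ^ 2) := sq_sum_seven_le _ _ _ _ _ _ _
    _ = 7 * s ^ 2 + 7 * (L ^ 2 * τ ^ 2 + ν ^ 2 * h' ^ 2 + L ^ 2 * k ^ 2 + L ^ 4 * K ^ 2 * h ^ 2
          + L ^ 4 * K ^ 2 * δ ^ 2 + L ^ 2 * (r * h' ^ 2)) := by
        rw [mul_pow (L * √r), mul_pow L √r, Real.sq_sqrt hr]; ring
    _ ≤ 7 * s ^ 2 + 7 * (c * τ ^ 2 + c * h' ^ 2 + c * k ^ 2 + c * h ^ 2 + c * δ ^ 2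
          + c * (r * h' ^ 2)) := by gcongr
    _ = _ := by ring

lemma two_mul_errResidual_le {ν₀ : ℝ} (hL : IsFormBound Ω L) (hν : 0 < ν) (hν₀ : ν ≤ ν₀)
    (hK : ‖grad (u (n + 1))‖ ≤ K) (v : X Ω) :
    2 * errResidual ν Δt u w uR η ξ κ n v
      ≤ ν * ‖grad v‖ ^ 2 + ν / 2 * ‖grad (ξ n)‖ ^ 2
        + 49 / 2 * L ^ 4 * K ^ 4 / ν ^ 3 * ‖vel (ξ n)‖ ^ 2
        + 7 * (ν₀ ^ 2 + L ^ 4 * (1 + K ^ 2)) / ν * consistencySq Δt u w uR η κ n := by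
  have hbound := errResidual_le (Δt := Δt) (w := w) (uR := uR) (η := η) (ξ := ξ) (κ := κ)
    hL hν.le hK v
  have hcoeff := sq_residual_coeff_le (K := K) (s := L * √(‖vel (ξ n)‖ * ‖grad (ξ n)‖) * K)
    (τ := ‖truncErr Δt u w n‖) (h := ‖grad (η n)‖) (h' := ‖grad (η (n + 1))‖) (k := ‖κ (n + 1)‖)
    (δ := ‖grad (u (n + 1) - u n)‖) (r := ‖vel (uR n)‖ * ‖grad (uR n)‖) hL.one_le hν.le hν₀
    (by positivity)
  have hξ := sq_convection_coeff_le (L := L) (K := K) hν (norm_nonneg (vel (ξ n)))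
    (norm_nonneg (grad (ξ n)))
  rw [← consistencySq] at hcoeff
  set σ := L * ‖truncErr Δt u w n‖ + _ + _ + _ + _ + _ + _
  set s := L * √(‖vel (ξ n)‖ * ‖grad (ξ n)‖) * K
  set c := ν₀ ^ 2 + L ^ 4 * (1 + K ^ 2)
  calc 2 * errResidual ν Δt u w uR η ξ κ n v ≤ 2 * ‖grad v‖ * σ := by linarith
    _ ≤ ν * ‖grad v‖ ^ 2 + ν⁻¹ * σ ^ 2 := two_mul_le_add_mul_sq hν
    _ ≤ ν * ‖grad v‖ ^ 2 + ν⁻¹ * (7 * s ^ 2 + 7 * c * consistencySq Δt u w uR η κ n) := by gcongr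
    _ = ν * ‖grad v‖ ^ 2 + 7 / ν * s ^ 2 + 7 * c / ν * consistencySq Δt u w uR η κ n := by ring
    _ ≤ _ := by linarith

end Residual

/-- The data term of the pressure equation in the step from node `n` to node `n + 1`, where the
pressure increments are bounded by `Δt * P`. -/
def pressureForcing (L α ε Δt c₁ P : ℝ) (η : ℕ → X Ω) (n : ℕ) : ℝ :=
  (4 * Δt / c₁ + 1) * (α * (L * ‖grad (η (n + 1))‖)) ^ 2 + ε * Δt * P ^ 2 * (4 * Δt + 1)

lemma pressure_young {ε Δt c₁ P a q r : ℝ} (hΔt : 0 < Δt) (hc₁ : 0 < c₁) (hε : c₁ * Δt ≤ ε) :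
    2 * Δt * (a * (q + r)) + 2 * ε * (Δt * P * (q + r))
      ≤ ε / 2 * r ^ 2 + Δt * (1 / c₁ + 1) * (ε * q ^ 2)
        + ((4 * Δt / c₁ + 1) * a ^ 2 + ε * Δt * P ^ 2 * (4 * Δt + 1)) := by
  have hε0 : 0 < ε := (mul_pos hc₁ hΔt).trans_le hε
  have hΔε : Δt ≤ ε / c₁ := by rwa [le_div_iff₀ hc₁, mul_comm]
  have haq : 2 * (Δt * q) * a ≤ Δt / c₁ * (ε * q ^ 2) + a ^ 2 :=
    calc 2 * (Δt * q) * a ≤ Δt * Δt * q ^ 2 + a ^ 2 := by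
          linarith [two_mul_le_add_sq (Δt * q) a]
      _ ≤ Δt * (ε / c₁) * q ^ 2 + a ^ 2 := by gcongr
      _ = _ := by ring
  have har : 2 * r * (Δt * a) ≤ ε / 4 * r ^ 2 + 4 * Δt / c₁ * a ^ 2 :=
    calc 2 * r * (Δt * a) ≤ c₁ * Δt / 4 * r ^ 2 + (c₁ * Δt / 4)⁻¹ * (Δt * a) ^ 2 :=
          two_mul_le_add_mul_sq (by positivity)
      _ = c₁ * Δt / 4 * r ^ 2 + 4 * Δt / c₁ * a ^ 2 := by field_simp
      _ ≤ _ := by gcongr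
  have hPq : ε * Δt * (2 * P * q) ≤ ε * Δt * (P ^ 2 + q ^ 2) := by
    gcongr; exact two_mul_le_add_sq P q
  have hPr : ε * (2 * r * (Δt * P)) ≤ ε * (1 / 4 * r ^ 2 + (1 / 4)⁻¹ * (Δt * P) ^ 2) := by
    gcongr; exact two_mul_le_add_mul_sq (by norm_num)
  have hsplit : Δt * (1 / c₁ + 1) * (ε * q ^ 2) = Δt / c₁ * (ε * q ^ 2) + Δt * (ε * q ^ 2) := by
    ring
  linarith

/-- The discrete energy of a velocity `v` and a pressure `q`. -/
def discEnergy (ν ε Δt : ℝ) (v : X Ω) (q : L2S Ω) : ℝ :=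
  ‖vel v‖ ^ 2 + ε * ‖q‖ ^ 2 + ν * Δt / 2 * ‖grad v‖ ^ 2

/-- The numerical and viscous dissipation in the step from node `n` to node `n + 1`. -/
def stepDissipation (ν ε Δt : ℝ) (v : ℕ → X Ω) (q : ℕ → L2S Ω) (n : ℕ) : ℝ :=
  ‖vel (v (n + 1)) - vel (v n)‖ ^ 2 + ε / 2 * ‖q (n + 1) - q n‖ ^ 2
    + ν * Δt / 2 * ‖grad (v (n + 1))‖ ^ 2

section Recursion

variable {XR : Submodule ℝ (X Ω)} {QM : Submodule ℝ (L2S Ω)} {L ν ε Δt : ℝ} {N n : ℕ}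
  {f w : ℕ → L2V Ω} {u uR η ξ : ℕ → X Ω} {p pM κ π : ℕ → L2S Ω}

lemma velocity_error_identity (hL : IsFormBound Ω L) (hΔt : Δt ≠ 0)
    (hNS : IsSampledNSE ν N f u w p) (hrom : IsACROM XR QM ν ε Δt N f uR pM)
    (he : IsErrorSplitting XR QM N u uR η ξ p pM κ π) (hn : n < N) :
    inner ℝ (vel (ξ (n + 1)) - vel (ξ n)) (vel (ξ (n + 1))) + Δt * ν * ‖grad (ξ (n + 1))‖ ^ 2
        - Δt * inner ℝ (π (n + 1)) (divg (ξ (n + 1)))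
      = Δt * errResidual ν Δt u w uR η ξ κ n (ξ (n + 1)) := by
  have hξ := he.mem_XR (n + 1) hn
  have hex := hNS.momentum (n + 1) hn (ξ (n + 1))
  have happ := hrom.velocity n hn _ hξ
  have hconv := hL.skewForm_sub_skewForm (u (n + 1)) (uR n) (u (n + 1)) (uR (n + 1)) (ξ (n + 1))
  have hshift : u (n + 1) - uR n = u (n + 1) - u n - (ξ n - η n) := by
    rw [← neg_sub (η n), ← he.sub_uR]; abel
  have huR (k : ℕ) : uR k = u k - η k + ξ k := by rw [sub_add, ← he.sub_uR]; abel
  have hpM : pM (n + 1) = p (n + 1) - κ (n + 1) + π (n + 1) := by rw [sub_add, ← he.sub_pM]; abel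
  rw [he.sub_uR, hshift, hL.skewForm_sub_left, hL.skewForm_sub_left (ξ n),
    hL.skewForm_sub_middle, skewForm_self] at hconv
  have hvel : vel (uR (n + 1)) - vel (uR n) = vel (u (n + 1)) - vel (u n)
      - (vel (η (n + 1)) - vel (η n)) + (vel (ξ (n + 1)) - vel (ξ n)) := by
    rw [huR, huR, map_add, map_add, map_sub, map_sub]; abel
  have hgrad : grad (uR (n + 1)) = grad (u (n + 1)) - grad (η (n + 1)) + grad (ξ (n + 1)) := by
    rw [huR, map_add, map_sub]
  rw [hvel, hgrad, hpM] at happ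
  rw [errResidual, truncErr, ← real_inner_self_eq_norm_sq]
  simp only [inner_add_left, inner_sub_left, real_inner_smul_left, he.inner_vel _ _ hξ]
    at happ ⊢
  field_simp at happ ⊢
  linear_combination happ - Δt * hex + Δt * hconv

lemma pressure_error_identity (hΔt : Δt ≠ 0) (hNS : IsSampledNSE ν N f u w p)
    (hrom : IsACROM XR QM ν ε Δt N f uR pM) (he : IsErrorSplitting XR QM N u uR η ξ p pM κ π)
    (hn : n < N) :
    ε * inner ℝ (π (n + 1) - π n) (π (n + 1)) + Δt * inner ℝ (divg (ξ (n + 1))) (π (n + 1))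
      = Δt * inner ℝ (divg (η (n + 1))) (π (n + 1))
        - ε * inner ℝ (p (n + 1) - p n) (π (n + 1)) := by
  have hπ := he.mem_QM (n + 1) hn
  have happ := hrom.pressure n hn _ hπ
  have hpM (k : ℕ) : pM k = p k - κ k + π k := by rw [sub_add, ← he.sub_pM]; abel
  have hp : pM (n + 1) - pM n
      = p (n + 1) - p n - (κ (n + 1) - κ n) + (π (n + 1) - π n) := by
    rw [hpM, hpM]; abel
  have hdivg : divg (uR (n + 1)) = divg (ξ (n + 1)) - divg (η (n + 1)) := by
    rw [← map_sub, ← neg_sub (η (n + 1)), ← he.sub_uR, neg_sub, map_sub,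
      hNS.divg_eq_zero (n + 1) hn, sub_zero]
  rw [hp, hdivg, real_inner_smul_left] at happ
  simp only [inner_add_left, inner_sub_left, he.inner_pres _ _ hπ] at happ ⊢
  field_simp at happ
  linear_combination happ

lemma error_energy_step {ν₀ K α c₁ P : ℝ} (hL : IsFormBound Ω L) (hν : 0 < ν) (hν₀ : ν ≤ ν₀)
    (hΔt : 0 < Δt) (hc₁ : 0 < c₁) (hε : c₁ * Δt ≤ ε) (hα : 0 ≤ α)
    (hNS : IsSampledNSE ν N f u w p) (hrom : IsACROM XR QM ν ε Δt N f uR pM)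
    (he : IsErrorSplitting XR QM N u uR η ξ p pM κ π) (hn : n < N)
    (hK : ‖grad (u (n + 1))‖ ≤ K) (hP : ‖p (n + 1) - p n‖ ≤ Δt * P)
    (hangle : inner ℝ (divg (η (n + 1))) (π (n + 1)) ≤ α * (‖divg (η (n + 1))‖ * ‖π (n + 1)‖)) :
    discEnergy ν ε Δt (ξ (n + 1)) (π (n + 1)) + stepDissipation ν ε Δt ξ π n
      ≤ (1 + Δt * (49 / 2 * L ^ 4 * K ^ 4 / ν ^ 3 + 1 / c₁ + 1)) * discEnergy ν ε Δt (ξ n) (π n)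
        + (Δt * (7 * (ν₀ ^ 2 + L ^ 4 * (1 + K ^ 2)) / ν * consistencySq Δt u w uR η κ n)
          + pressureForcing L α ε Δt c₁ P η n) := by
  have hε0 : 0 < ε := (mul_pos hc₁ hΔt).trans_le hε
  have hL0 : 0 ≤ L := zero_le_one.trans hL.one_le
  have hvel := velocity_error_identity hL hΔt.ne' hNS hrom he hn
  have hpres := pressure_error_identity hΔt.ne' hNS hrom he hn
  have hresid := mul_le_mul_of_nonneg_left (two_mul_errResidual_le (Δt := Δt) (w := w) (uR := uR)
    (η := η) (ξ := ξ) (κ := κ) hL hν hν₀ hK (ξ (n + 1))) hΔt.le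
  have hπ : ‖π (n + 1)‖ ≤ ‖π n‖ + ‖π (n + 1) - π n‖ := by
    linarith [norm_sub_norm_le (π (n + 1)) (π n)]
  have hdiv : inner ℝ (divg (η (n + 1))) (π (n + 1))
      ≤ α * (L * ‖grad (η (n + 1))‖) * (‖π n‖ + ‖π (n + 1) - π n‖) := by
    rw [mul_assoc]
    exact hangle.trans (by gcongr; exact hL.norm_divg_le _)
  have hincr : -inner ℝ (p (n + 1) - p n) (π (n + 1))
      ≤ Δt * P * (‖π n‖ + ‖π (n + 1) - π n‖) :=
    (neg_le_abs _).trans <| (abs_real_inner_le_norm _ _).trans <|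
      mul_le_mul hP hπ (norm_nonneg _) ((norm_nonneg _).trans hP)
  have hyoung := pressure_young (P := P) (a := α * (L * ‖grad (η (n + 1))‖)) (q := ‖π n‖)
    (r := ‖π (n + 1) - π n‖) hΔt hc₁ hε
  have hdiv' := mul_le_mul_of_nonneg_left hdiv (by positivity : 0 ≤ 2 * Δt)
  have hincr' := mul_le_mul_of_nonneg_left hincr (by positivity : 0 ≤ 2 * ε)
  have hvelinc := two_inner_sub_self (vel (ξ (n + 1))) (vel (ξ n))
  have hpresinc := congrArg (ε * ·) (two_inner_sub_self (π (n + 1)) (π n))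
  have hdrop : 0 ≤ Δt * (49 / 2 * L ^ 4 * K ^ 4 / ν ^ 3) * (ε * ‖π n‖ ^ 2)
      + Δt * (1 / c₁ + 1) * ‖vel (ξ n)‖ ^ 2
      + Δt * (49 / 2 * L ^ 4 * K ^ 4 / ν ^ 3 + 1 / c₁ + 1)
        * (ν * Δt / 2 * ‖grad (ξ n)‖ ^ 2) := by positivity
  rw [real_inner_comm (divg (ξ (n + 1)))] at hvel
  rw [discEnergy, discEnergy, stepDissipation, pressureForcing]
  linarith

end Recursion

/-! ### Summation over the time steps -/

/-- The part of the error bound that depends only on the exact solution and on its projection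
errors; `I`, `J` and `P` stand for `‖u_tt‖²`, `‖∇u_t‖²` (in `L²(0, T; L²)`) and for the norm of
`p_t` in `L^∞(0, T; L²)`. -/
def approxData (ν Δt α : ℝ) (N : ℕ) (η : ℕ → X Ω) (κ : ℕ → L2S Ω) (I J P : ℝ) : ℝ :=
  (1 / ν + α ^ 2 * Δt⁻¹) * discL2sq Δt N (fun n => grad (η n)) + 1 / ν * discL2sq Δt N κ
    + Δt ^ 2 / ν * I + Δt ^ 2 / ν * J
    + Δt ^ (1 / 2 : ℝ) / ν ^ (3 / 2 : ℝ)
      * (∑ n ∈ Finset.range N, ‖grad (η (n + 1))‖ ^ 4) ^ (1 / 2 : ℝ)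
    + Δt * P ^ 2

section DiscL2sq

variable {E : Type*} [NormedAddCommGroup E] {Δt : ℝ}

lemma discL2sq_nonneg (hΔt : 0 ≤ Δt) (N : ℕ) (g : ℕ → E) : 0 ≤ discL2sq Δt N g := by
  rw [discL2sq]; positivity

lemma sum_init_sq_le_discL2sq (hΔt : 0 ≤ Δt) (N : ℕ) (g : ℕ → E) :
    Δt * ∑ n ∈ Finset.range N, ‖g n‖ ^ 2 ≤ discL2sq Δt N g := by
  rw [discL2sq, Finset.sum_range_succ]
  gcongr
  exact le_add_of_nonneg_right (sq_nonneg _)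

lemma sum_tail_sq_le_discL2sq (hΔt : 0 ≤ Δt) (N : ℕ) (g : ℕ → E) :
    Δt * ∑ n ∈ Finset.range N, ‖g (n + 1)‖ ^ 2 ≤ discL2sq Δt N g := by
  rw [discL2sq, Finset.sum_range_succ']
  gcongr
  exact le_add_of_nonneg_right (sq_nonneg _)

end DiscL2sq

lemma sum_convection_le {ν Δt K : ℝ} (hν : 0 < ν) (hΔt : 0 < Δt) (hK : 0 ≤ K) {N : ℕ}
    {a b h : ℕ → ℝ} (hb : ∀ n, 0 ≤ b n) (haK : ∀ n < N, a n ^ 2 ≤ K)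
    (hbK : ν * Δt * ∑ n ∈ Finset.range N, b n ^ 2 ≤ K) :
    Δt / ν * ∑ n ∈ Finset.range N, a n * b n * h n ^ 2
      ≤ K * (Δt ^ (1 / 2 : ℝ) / ν ^ (3 / 2 : ℝ)
        * (∑ n ∈ Finset.range N, h n ^ 4) ^ (1 / 2 : ℝ)) := by
  have hsup : ∑ n ∈ Finset.range N, a n * b n * h n ^ 2
      ≤ √K * ∑ n ∈ Finset.range N, b n * h n ^ 2 := by
    rw [Finset.mul_sum]
    refine Finset.sum_le_sum fun n hn => ?_
    have han : a n ≤ √K := Real.le_sqrt_of_sq_le (haK n (Finset.mem_range.mp hn))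
    rw [mul_assoc]
    exact mul_le_mul_of_nonneg_right han (mul_nonneg (hb n) (sq_nonneg _))
  have hcauchy : ∑ n ∈ Finset.range N, b n * h n ^ 2
      ≤ √(∑ n ∈ Finset.range N, b n ^ 2) * √(∑ n ∈ Finset.range N, h n ^ 4) :=
    (Real.sum_mul_le_sqrt_mul_sqrt _ b fun n => h n ^ 2).trans_eq (by simp only [← pow_mul])
  have hbsum : √(∑ n ∈ Finset.range N, b n ^ 2) ≤ √K / (√ν * √Δt) := by
    rw [← Real.sqrt_mul hν.le, ← Real.sqrt_div hK]
    exact Real.sqrt_le_sqrt (by rwa [le_div_iff₀ (by positivity), mul_comm])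
  have hν3 : ν ^ (3 / 2 : ℝ) = ν * √ν := by
    rw [Real.sqrt_eq_rpow, show (3 / 2 : ℝ) = 1 + 1 / 2 by norm_num, Real.rpow_add hν,
      Real.rpow_one]
  rw [← Real.sqrt_eq_rpow, ← Real.sqrt_eq_rpow, hν3]
  calc Δt / ν * ∑ n ∈ Finset.range N, a n * b n * h n ^ 2
      ≤ Δt / ν * (√K * (√K / (√ν * √Δt) * √(∑ n ∈ Finset.range N, h n ^ 4))) := by
        gcongr
        exact hsup.trans (by gcongr; exact hcauchy.trans (by gcongr))
    _ = √K ^ 2 * (Δt / √Δt / (ν * √ν) * √(∑ n ∈ Finset.range N, h n ^ 4)) := by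
        field_simp
    _ = _ := by rw [Real.sq_sqrt hK, Real.div_sqrt]

section Sums

variable {ν Δt α I J P : ℝ} {N : ℕ} {η : ℕ → X Ω} {κ : ℕ → L2S Ω}

lemma mul_discL2sq_le_approxData (hν : 0 ≤ ν) (hΔt : 0 ≤ Δt) (hI : 0 ≤ I) (hJ : 0 ≤ J) :
    (1 / ν + α ^ 2 * Δt⁻¹) * discL2sq Δt N (fun n => grad (η n))
      ≤ approxData ν Δt α N η κ I J P := by
  have hκ := discL2sq_nonneg hΔt N κ
  rw [approxData, add_assoc, add_assoc, add_assoc, add_assoc]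
  exact le_add_of_nonneg_right (by positivity)

lemma approxData_nonneg (hν : 0 ≤ ν) (hΔt : 0 ≤ Δt) (hI : 0 ≤ I) (hJ : 0 ≤ J) :
    0 ≤ approxData ν Δt α N η κ I J P := by
  have hη := discL2sq_nonneg hΔt N fun n => grad (η n)
  exact le_trans (by positivity) (mul_discL2sq_le_approxData hν hΔt hI hJ)

lemma sum_consistencySq_le {K : ℝ} {u uR : ℕ → X Ω} {w : ℕ → L2V Ω} (hν : 0 < ν) (hΔt : 0 < Δt)
    (hK : 0 ≤ K) (hI₀ : 0 ≤ I) (hJ₀ : 0 ≤ J) (huR : ∀ n < N, ‖vel (uR n)‖ ^ 2 ≤ K)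
    (hgrad : ν * Δt * ∑ n ∈ Finset.range N, ‖grad (uR n)‖ ^ 2 ≤ K)
    (hI : ∑ n ∈ Finset.range N, ‖truncErr Δt u w n‖ ^ 2 ≤ Δt * I)
    (hJ : ∑ n ∈ Finset.range N, ‖grad (u (n + 1) - u n)‖ ^ 2 ≤ Δt * J) :
    Δt / ν * ∑ n ∈ Finset.range N, consistencySq Δt u w uR η κ n
      ≤ (2 + K) * approxData ν Δt α N η κ I J P := by
  have hconv := sum_convection_le (h := fun n => ‖grad (η (n + 1))‖) hν hΔt hK
    (fun n => norm_nonneg (grad (uR n))) huR hgrad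
  have hη := sum_init_sq_le_discL2sq hΔt.le N fun n => grad (η n)
  have hη' := sum_tail_sq_le_discL2sq hΔt.le N fun n => grad (η n)
  have hκ := sum_tail_sq_le_discL2sq hΔt.le N κ
  have hH₀ := discL2sq_nonneg hΔt.le N fun n => grad (η n)
  have hκ₀ := discL2sq_nonneg hΔt.le N κ
  rw [approxData]
  set H := discL2sq Δt N fun n => grad (η n)
  set Q := Δt ^ (1 / 2 : ℝ) / ν ^ (3 / 2 : ℝ)
    * (∑ n ∈ Finset.range N, ‖grad (η (n + 1))‖ ^ 4) ^ (1 / 2 : ℝ)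
  have : 0 ≤ Q := by positivity
  calc _ = Δt / ν * ∑ n ∈ Finset.range N, ‖truncErr Δt u w n‖ ^ 2
        + 1 / ν * (Δt * ∑ n ∈ Finset.range N, ‖grad (η (n + 1))‖ ^ 2)
        + 1 / ν * (Δt * ∑ n ∈ Finset.range N, ‖κ (n + 1)‖ ^ 2)
        + 1 / ν * (Δt * ∑ n ∈ Finset.range N, ‖grad (η n)‖ ^ 2)
        + Δt / ν * ∑ n ∈ Finset.range N, ‖grad (u (n + 1) - u n)‖ ^ 2
        + Δt / ν * ∑ n ∈ Finset.range N,
            ‖vel (uR n)‖ * ‖grad (uR n)‖ * ‖grad (η (n + 1))‖ ^ 2 := by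
        simp only [consistencySq, Finset.sum_add_distrib]
        ring
    _ ≤ Δt / ν * (Δt * I) + 1 / ν * H + 1 / ν * discL2sq Δt N κ + 1 / ν * H
        + Δt / ν * (Δt * J) + K * Q := by gcongr
    _ ≤ Δt / ν * (Δt * I) + 1 / ν * H + 1 / ν * discL2sq Δt N κ + 1 / ν * H
        + Δt / ν * (Δt * J) + K * Q
        + ((1 + K) * (1 / ν * discL2sq Δt N κ + Δt ^ 2 / ν * I + Δt ^ 2 / ν * J)
          + K * (1 / ν * H) + (2 + K) * (α ^ 2 * Δt⁻¹ * H + Δt * P ^ 2) + 2 * Q) :=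
        le_add_of_nonneg_right (by positivity)
    _ = _ := by ring

lemma sum_pressureForcing_le {L ν₀ ε c₁ c₂ T : ℝ} (hν : 0 < ν) (hν₀ : ν ≤ ν₀) (hΔt : 0 < Δt)
    (hT : Δt * N = T) (hc₁ : 0 < c₁) (hc₂ : 0 ≤ c₂) (hα : α ^ 2 ≤ 1) (hε : ε ≤ c₂ * Δt) :
    ∑ n ∈ Finset.range N, pressureForcing L α ε Δt c₁ P η n
      ≤ L ^ 2 * (4 * ν₀ / c₁ + 1)
          * ((1 / ν + α ^ 2 * Δt⁻¹) * discL2sq Δt N (fun n => grad (η n)))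
        + 9 * c₂ * Real.exp T * (Δt * P ^ 2) := by
  have hH₀ := discL2sq_nonneg hΔt.le N fun n => grad (η n)
  have hη' := sum_tail_sq_le_discL2sq hΔt.le N fun n => grad (η n)
  set H := discL2sq Δt N fun n => grad (η n)
  have hT₀ : 0 ≤ T := hT ▸ by positivity
  have hν₀' : 0 < ν₀ := hν.trans_le hν₀
  have hα' : α ^ 2 ≤ ν₀ / ν := hα.trans ((one_le_div hν).2 hν₀)
  have hgrad : (4 * Δt / c₁ + 1) * α ^ 2 * L ^ 2 * ∑ n ∈ Finset.range N, ‖grad (η (n + 1))‖ ^ 2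
      ≤ L ^ 2 * (4 * ν₀ / c₁ + 1) * ((1 / ν + α ^ 2 * Δt⁻¹) * H) := by
    calc _ = L ^ 2 * (4 / c₁ * α ^ 2 + α ^ 2 * Δt⁻¹)
          * (Δt * ∑ n ∈ Finset.range N, ‖grad (η (n + 1))‖ ^ 2) := by field_simp
      _ ≤ L ^ 2 * (4 / c₁ * (ν₀ / ν) + α ^ 2 * Δt⁻¹) * H := by gcongr
      _ ≤ L ^ 2 * (4 / c₁ * (ν₀ / ν) + α ^ 2 * Δt⁻¹) * H
          + L ^ 2 * (1 / ν + 4 * ν₀ / c₁ * (α ^ 2 * Δt⁻¹)) * H :=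
        le_add_of_nonneg_right (by positivity)
      _ = _ := by ring
  have htime : N * (Δt * (4 * Δt + 1)) ≤ 9 * Real.exp T := by
    have hN : (N : ℝ) ≤ N * N := by exact_mod_cast Nat.le_mul_self N
    calc N * (Δt * (4 * Δt + 1)) = 4 * (N * Δt ^ 2) + Δt * N := by ring
      _ ≤ 4 * (N * N * Δt ^ 2) + Δt * N := by gcongr
      _ = 4 * T ^ 2 + T := by rw [← hT]; ring
      _ ≤ _ := by linarith [Real.quadratic_le_exp_of_nonneg hT₀, sq_nonneg T]
  have hpres : ε * (N * (Δt * (4 * Δt + 1))) * P ^ 2 ≤ 9 * c₂ * Real.exp T * (Δt * P ^ 2) := by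
    calc _ ≤ c₂ * Δt * (9 * Real.exp T) * P ^ 2 := by gcongr
      _ = _ := by ring
  calc _ = (4 * Δt / c₁ + 1) * α ^ 2 * L ^ 2 * ∑ n ∈ Finset.range N, ‖grad (η (n + 1))‖ ^ 2
        + ε * (N * (Δt * (4 * Δt + 1))) * P ^ 2 := by
        simp only [pressureForcing, Finset.sum_add_distrib, Finset.sum_const, Finset.card_range,
          nsmul_eq_mul, mul_pow, ← Finset.mul_sum]
        ring
    _ ≤ _ := add_le_add hgrad hpres

/-- The constant in front of the approximation data in the sum of the forcing terms. -/
def forcingConst (L ν₀ c₁ c₂ K : ℝ) : ℝ :=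
  7 * (ν₀ ^ 2 + L ^ 4 * (1 + K ^ 2)) * (2 + K) + L ^ 2 * (4 * ν₀ / c₁ + 1) + 9 * c₂

lemma sum_forcing_le {L ν₀ ε c₁ c₂ K T : ℝ} {u uR : ℕ → X Ω} {w : ℕ → L2V Ω} (hν : 0 < ν)
    (hν₀ : ν ≤ ν₀) (hΔt : 0 < Δt) (hT : Δt * N = T) (hc₁ : 0 < c₁) (hc₂ : 0 ≤ c₂) (hα : α ^ 2 ≤ 1)
    (hε : ε ≤ c₂ * Δt) (hK : 0 ≤ K) (hI₀ : 0 ≤ I) (hJ₀ : 0 ≤ J)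
    (huR : ∀ n < N, ‖vel (uR n)‖ ^ 2 ≤ K)
    (hgrad : ν * Δt * ∑ n ∈ Finset.range N, ‖grad (uR n)‖ ^ 2 ≤ K)
    (hI : ∑ n ∈ Finset.range N, ‖truncErr Δt u w n‖ ^ 2 ≤ Δt * I)
    (hJ : ∑ n ∈ Finset.range N, ‖grad (u (n + 1) - u n)‖ ^ 2 ≤ Δt * J) :
    ∑ n ∈ Finset.range N,
        (Δt * (7 * (ν₀ ^ 2 + L ^ 4 * (1 + K ^ 2)) / ν * consistencySq Δt u w uR η κ n)
          + pressureForcing L α ε Δt c₁ P η n)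
      ≤ forcingConst L ν₀ c₁ c₂ K * Real.exp T * approxData ν Δt α N η κ I J P := by
  have hcons := sum_consistencySq_le (α := α) (P := P) (η := η) (κ := κ) hν hΔt hK hI₀ hJ₀ huR
    hgrad hI hJ
  have hpres := sum_pressureForcing_le (L := L) (P := P) (η := η) hν hν₀ hΔt hT hc₁ hc₂ hα hε
  have hH₀ := discL2sq_nonneg hΔt.le N fun n => grad (η n)
  have hκ₀ := discL2sq_nonneg hΔt.le N κ
  have hT₀ : 1 ≤ Real.exp T := Real.one_le_exp (hT ▸ by positivity)
  have hν₀' := hν.trans_le hν₀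
  set W := approxData ν Δt α N η κ I J P
  set c := ν₀ ^ 2 + L ^ 4 * (1 + K ^ 2)
  have hWη : (1 / ν + α ^ 2 * Δt⁻¹) * discL2sq Δt N (fun n => grad (η n)) ≤ W :=
    mul_discL2sq_le_approxData hν.le hΔt.le hI₀ hJ₀
  have hWP : Δt * P ^ 2 ≤ W := le_add_of_nonneg_left (by positivity)
  have hW₀ : 0 ≤ W := approxData_nonneg hν.le hΔt.le hI₀ hJ₀
  calc _ = 7 * c * (Δt / ν * ∑ n ∈ Finset.range N, consistencySq Δt u w uR η κ n)
        + ∑ n ∈ Finset.range N, pressureForcing L α ε Δt c₁ P η n := by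
        rw [Finset.sum_add_distrib, ← Finset.mul_sum, ← Finset.mul_sum]; ring
    _ ≤ 7 * c * ((2 + K) * W) + (L ^ 2 * (4 * ν₀ / c₁ + 1) * W + 9 * c₂ * Real.exp T * W) := by
        gcongr
        exact hpres.trans (by gcongr)
    _ = (7 * c * (2 + K) + L ^ 2 * (4 * ν₀ / c₁ + 1)) * 1 * W + 9 * c₂ * Real.exp T * W := by ring
    _ ≤ (7 * c * (2 + K) + L ^ 2 * (4 * ν₀ / c₁ + 1)) * Real.exp T * W
        + 9 * c₂ * Real.exp T * W := by gcongr
    _ = _ := by rw [forcingConst]; ring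

end Sums

/-! ### The error estimate -/

lemma norm_sub_sq_of_inner_eq_zero {H : Type*} [NormedAddCommGroup H] [InnerProductSpace ℝ H]
    {x y : H} (h : inner ℝ x y = 0) : ‖x - y‖ ^ 2 = ‖x‖ ^ 2 + ‖y‖ ^ 2 := by
  rw [norm_sub_sq_real, h]; ring

lemma sq_norm_sub_le {E : Type*} [SeminormedAddCommGroup E] (x y : E) :
    ‖x - y‖ ^ 2 ≤ 2 * ‖x‖ ^ 2 + 2 * ‖y‖ ^ 2 :=
  calc ‖x - y‖ ^ 2 ≤ (‖x‖ + ‖y‖) ^ 2 := by gcongr; exact norm_sub_le x y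
    _ ≤ 2 * (‖x‖ ^ 2 + ‖y‖ ^ 2) := add_sq_le
    _ = _ := by ring

lemma isErrorSplitting_proj {R M N : ℕ} {φ : Fin R → X Ω} {ψ : Fin M → L2S Ω} {ν ε Δt : ℝ}
    {f : ℕ → L2V Ω} {uR : ℕ → X Ω} {pM : ℕ → L2S Ω} (hφ : Orthonormal ℝ fun j => vel (φ j))
    (hψ : Orthonormal ℝ ψ)
    (hrom : IsACROM (Submodule.span ℝ (range φ)) (Submodule.span ℝ (range ψ)) ν ε Δt N f uR pM)
    (u : ℕ → X Ω) (p : ℕ → L2S Ω) :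
    IsErrorSplitting (Submodule.span ℝ (range φ)) (Submodule.span ℝ (range ψ)) N u uR
      (fun n => u n - velProj φ (u n)) (fun n => uR n - velProj φ (u n)) p pM
      (fun n => p n - presProj ψ (p n)) (fun n => pM n - presProj ψ (p n)) where
  sub_uR _ := (sub_sub_sub_cancel_right _ _ _).symm
  sub_pM _ := (sub_sub_sub_cancel_right _ _ _).symm
  mem_XR n hn := Submodule.sub_mem _ (hrom.mem_XR n hn) (velProj_mem φ _)
  mem_QM n hn := Submodule.sub_mem _ (hrom.mem_QM n hn) (presProj_mem ψ _)
  inner_vel _ := velProj_orthogonal hφ _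
  inner_pres _ := presProj_orthogonal hψ _

namespace IsErrorSplitting

variable {XR : Submodule ℝ (X Ω)} {QM : Submodule ℝ (L2S Ω)} {N : ℕ} {u uR η ξ : ℕ → X Ω}
  {p pM κ π : ℕ → L2S Ω}

lemma sq_norm_vel_increment (he : IsErrorSplitting XR QM N u uR η ξ p pM κ π) {n : ℕ}
    (hn : n < N) :
    ‖vel (u (n + 1) - uR (n + 1)) - vel (u n - uR n)‖ ^ 2
      = ‖vel (η (n + 1)) - vel (η n)‖ ^ 2 + ‖vel (ξ (n + 1)) - vel (ξ n)‖ ^ 2 := by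
  have hmem := XR.sub_mem (he.mem_XR (n + 1) hn) (he.mem_XR n hn.le)
  have horth : inner ℝ (vel (η (n + 1)) - vel (η n)) (vel (ξ (n + 1)) - vel (ξ n)) = 0 := by
    rw [← map_sub vel (ξ _), inner_sub_left, he.inner_vel _ _ hmem, he.inner_vel _ _ hmem,
      sub_zero]
  rw [he.sub_uR, he.sub_uR, map_sub, map_sub, sub_sub_sub_comm, norm_sub_sq_of_inner_eq_zero horth]

lemma sq_norm_pres_increment (he : IsErrorSplitting XR QM N u uR η ξ p pM κ π) {n : ℕ}
    (hn : n < N) :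
    ‖p (n + 1) - pM (n + 1) - (p n - pM n)‖ ^ 2
      = ‖κ (n + 1) - κ n‖ ^ 2 + ‖π (n + 1) - π n‖ ^ 2 := by
  have hmem := QM.sub_mem (he.mem_QM (n + 1) hn) (he.mem_QM n hn.le)
  have horth : inner ℝ (κ (n + 1) - κ n) (π (n + 1) - π n) = 0 := by
    rw [inner_sub_left, he.inner_pres _ _ hmem, he.inner_pres _ _ hmem, sub_zero]
  rw [he.sub_pM, he.sub_pM, sub_sub_sub_comm, norm_sub_sq_of_inner_eq_zero horth]

lemma sq_norm_grad_le (he : IsErrorSplitting XR QM N u uR η ξ p pM κ π) (n : ℕ) :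
    ‖grad (u n - uR n)‖ ^ 2 ≤ 2 * ‖grad (η n)‖ ^ 2 + 2 * ‖grad (ξ n)‖ ^ 2 := by
  rw [he.sub_uR, map_sub]
  exact sq_norm_sub_le _ _

lemma discL2sq_grad_le (he : IsErrorSplitting XR QM N u uR η ξ p pM κ π) {Δt : ℝ}
    (hΔt : 0 ≤ Δt) :
    discL2sq Δt N (fun n => grad (u n - uR n))
      ≤ 2 * discL2sq Δt N (fun n => grad (η n)) + 2 * discL2sq Δt N (fun n => grad (ξ n)) :=
  calc _ ≤ Δt * ∑ n ∈ Finset.range (N + 1), (2 * ‖grad (η n)‖ ^ 2 + 2 * ‖grad (ξ n)‖ ^ 2) := by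
        rw [discL2sq]; gcongr with n; exact he.sq_norm_grad_le n
    _ = _ := by rw [discL2sq, discL2sq, Finset.sum_add_distrib, ← Finset.mul_sum,
      ← Finset.mul_sum]; ring

lemma sum_increments_eq (he : IsErrorSplitting XR QM N u uR η ξ p pM κ π) (ε : ℝ) :
    ∑ n ∈ Finset.range N, (‖vel (u (n + 1) - uR (n + 1)) - vel (u n - uR n)‖ ^ 2
        + ε / 2 * ‖p (n + 1) - pM (n + 1) - (p n - pM n)‖ ^ 2)
      = ∑ n ∈ Finset.range N,
          (‖vel (η (n + 1)) - vel (η n)‖ ^ 2 + ε / 2 * ‖κ (n + 1) - κ n‖ ^ 2)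
        + ∑ n ∈ Finset.range N,
          (‖vel (ξ (n + 1)) - vel (ξ n)‖ ^ 2 + ε / 2 * ‖π (n + 1) - π n‖ ^ 2) := by
  rw [← Finset.sum_add_distrib]
  refine Finset.sum_congr rfl fun n hn => ?_
  have hvel := he.sq_norm_vel_increment (Finset.mem_range.1 hn)
  have hpres := he.sq_norm_pres_increment (Finset.mem_range.1 hn)
  linear_combination hvel + ε / 2 * hpres

lemma errEnergy_le (he : IsErrorSplitting XR QM N u uR η ξ p pM κ π) {ν ε Δt : ℝ} (hν : 0 ≤ ν)
    (hε : 0 ≤ ε) (hΔt : 0 ≤ Δt) :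
    errEnergy ν ε Δt N (fun n => u n - uR n) (fun n => p n - pM n)
      ≤ errEnergy ν ε Δt N η κ
        + 2 * (discEnergy ν ε Δt (ξ N) (π N)
          + ∑ n ∈ Finset.range N, stepDissipation ν ε Δt ξ π n)
        + Δt * ν * ‖grad (ξ 0)‖ ^ 2 + ν * discL2sq Δt N (fun n => grad (η n)) := by
  have hdrop : 0 ≤ ‖vel (ξ N)‖ ^ 2 + ε * ‖π N‖ ^ 2 + ∑ n ∈ Finset.range N,
      (‖vel (ξ (n + 1)) - vel (ξ n)‖ ^ 2 + ε / 2 * ‖π (n + 1) - π n‖ ^ 2) := by positivity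
  have hvelN : ‖vel (u N - uR N)‖ ^ 2 = ‖vel (η N)‖ ^ 2 + ‖vel (ξ N)‖ ^ 2 := by
    rw [he.sub_uR, map_sub,
      norm_sub_sq_of_inner_eq_zero (he.inner_vel N _ (he.mem_XR N le_rfl))]
  have hpresN : ‖p N - pM N‖ ^ 2 = ‖κ N‖ ^ 2 + ‖π N‖ ^ 2 := by
    rw [he.sub_pM, norm_sub_sq_of_inner_eq_zero (he.inner_pres N _ (he.mem_QM N le_rfl))]
  have hgradN := mul_le_mul_of_nonneg_left (he.sq_norm_grad_le N) (by positivity : 0 ≤ ν * Δt / 2)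
  have hgrad := mul_le_mul_of_nonneg_left (he.discL2sq_grad_le hΔt) (by positivity : 0 ≤ ν / 2)
  have hξ : discL2sq Δt N (fun n => grad (ξ n))
      = Δt * ∑ n ∈ Finset.range N, ‖grad (ξ (n + 1))‖ ^ 2 + Δt * ‖grad (ξ 0)‖ ^ 2 := by
    rw [discL2sq, Finset.sum_range_succ', mul_add]
  have hηN : Δt * ‖grad (η N)‖ ^ 2 ≤ discL2sq Δt N (fun n => grad (η n)) := by
    rw [discL2sq]
    gcongr
    exact Finset.single_le_sum (f := fun n => ‖grad (η n)‖ ^ 2) (fun _ _ => sq_nonneg _)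
      (Finset.self_mem_range_succ N)
  have hηN' := mul_le_mul_of_nonneg_left hηN hν
  simp only [errEnergy, discEnergy, stepDissipation, hvelN, hpresN, he.sum_increments_eq]
  rw [hξ] at hgrad
  rw [Finset.sum_add_distrib (g := fun n => ν * Δt / 2 * _), ← Finset.mul_sum]
  linarith

end IsErrorSplitting

/-- The exponential growth rate, in units of `T / ν ^ 3`, of the error estimate. -/
def errorRate (L ν₀ c₁ K : ℝ) : ℝ := 49 / 2 * L ^ 4 * K ^ 4 + (1 / c₁ + 2) * ν₀ ^ 3

/-- The constant in front of the exponential in the error estimate. -/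
def errorConst (L ν₀ c₁ c₂ K : ℝ) : ℝ := 2 * forcingConst L ν₀ c₁ c₂ K + 3 + ν₀ ^ 2

lemma gronwall_exponent_le {L ν ν₀ c₁ K T : ℝ} (hν : 0 < ν) (hν₀ : ν ≤ ν₀) (hc₁ : 0 < c₁)
    (hT : 0 ≤ T) :
    T * (49 / 2 * L ^ 4 * K ^ 4 / ν ^ 3 + 1 / c₁ + 1) + T ≤ errorRate L ν₀ c₁ K * T / ν ^ 3 := by
  have hratio : 1 ≤ ν₀ ^ 3 / ν ^ 3 := (one_le_div (by positivity)).2 (by gcongr)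
  calc _ = 49 / 2 * L ^ 4 * K ^ 4 * T / ν ^ 3 + (1 / c₁ + 2) * T * 1 := by ring
    _ ≤ 49 / 2 * L ^ 4 * K ^ 4 * T / ν ^ 3 + (1 / c₁ + 2) * T * (ν₀ ^ 3 / ν ^ 3) := by gcongr
    _ = _ := by rw [errorRate]; ring

lemma forcingConst_nonneg (L : ℝ) {ν₀ c₁ c₂ K : ℝ} (hν₀ : 0 ≤ ν₀) (hc₁ : 0 < c₁) (hc₂ : 0 ≤ c₂)
    (hK : 0 ≤ K) : 0 ≤ forcingConst L ν₀ c₁ c₂ K := by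
  rw [forcingConst]; positivity

lemma IsErrorSplitting.errEnergy_le_of_discEnergy_le {XR : Submodule ℝ (X Ω)}
    {QM : Submodule ℝ (L2S Ω)} {N : ℕ} {u uR η ξ : ℕ → X Ω} {p pM κ π : ℕ → L2S Ω}
    (he : IsErrorSplitting XR QM N u uR η ξ p pM κ π) {ν ν₀ ε Δt A W ρ : ℝ} (hν : 0 < ν)
    (hν₀ : ν ≤ ν₀) (hε : 0 ≤ ε) (hΔt : 0 ≤ Δt) (hA : 0 ≤ A) (hρ : 0 ≤ ρ)
    (hη : 1 / ν * discL2sq Δt N (fun n => grad (η n)) ≤ W)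
    (hdisc : discEnergy ν ε Δt (ξ N) (π N) + ∑ n ∈ Finset.range N, stepDissipation ν ε Δt ξ π n
      ≤ Real.exp ρ * (discEnergy ν ε Δt (ξ 0) (π 0) + A * W)) :
    errEnergy ν ε Δt N (fun n => u n - uR n) (fun n => p n - pM n)
      ≤ errEnergy ν ε Δt N η κ + (2 * A + 3 + ν₀ ^ 2) * Real.exp ρ
        * (‖vel (ξ 0)‖ ^ 2 + ε * ‖π 0‖ ^ 2 + Δt * ν * ‖grad (ξ 0)‖ ^ 2 + W) := by
  set B := ‖vel (ξ 0)‖ ^ 2 + ε * ‖π 0‖ ^ 2 + Δt * ν * ‖grad (ξ 0)‖ ^ 2 with hB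
  have hB₀ : 0 ≤ B := by positivity
  have hgrad₀ : Δt * ν * ‖grad (ξ 0)‖ ^ 2 ≤ B := le_add_of_nonneg_left (by positivity)
  have henergy₀ : discEnergy ν ε Δt (ξ 0) (π 0) ≤ B := by
    have : 0 ≤ Δt * ν * ‖grad (ξ 0)‖ ^ 2 := by positivity
    rw [discEnergy, hB]
    linarith
  have hηL : 0 ≤ 1 / ν * discL2sq Δt N (fun n => grad (η n)) :=
    mul_nonneg (by positivity) (discL2sq_nonneg hΔt N _)
  have hW : 0 ≤ W := hηL.trans hη
  have hproj : ν * discL2sq Δt N (fun n => grad (η n)) ≤ ν₀ ^ 2 * W :=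
    calc _ = ν ^ 2 * (1 / ν * discL2sq Δt N (fun n => grad (η n))) := by field_simp
      _ ≤ ν₀ ^ 2 * W := mul_le_mul (by gcongr) hη hηL (sq_nonneg _)
  calc _ ≤ errEnergy ν ε Δt N η κ + 2 * (Real.exp ρ * (B + A * W)) + B + ν₀ ^ 2 * W := by
        refine (he.errEnergy_le hν.le hε hΔt).trans ?_
        gcongr
        exact hdisc.trans (by gcongr)
    _ ≤ errEnergy ν ε Δt N η κ + 2 * (Real.exp ρ * (B + A * W)) + Real.exp ρ * B
        + Real.exp ρ * (ν₀ ^ 2 * W) :=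
        add_le_add (add_le_add_right (le_mul_of_one_le_left hB₀ (Real.one_le_exp hρ)) _)
          (le_mul_of_one_le_left (mul_nonneg (sq_nonneg _) hW) (Real.one_le_exp hρ))
    _ ≤ errEnergy ν ε Δt N η κ + 2 * (Real.exp ρ * (B + A * W)) + Real.exp ρ * B
        + Real.exp ρ * (ν₀ ^ 2 * W) + Real.exp ρ * (2 * A * B + ν₀ ^ 2 * B + 3 * W) :=
        le_add_of_nonneg_right (by positivity)
    _ = _ := by ring

lemma errorRate_pos (L K : ℝ) {ν₀ c₁ : ℝ} (hν₀ : 0 < ν₀) (hc₁ : 0 < c₁) :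
    0 < errorRate L ν₀ c₁ K := by
  rw [errorRate]; positivity

lemma errorConst_pos (L : ℝ) {ν₀ c₁ c₂ K : ℝ} (hν₀ : 0 ≤ ν₀) (hc₁ : 0 < c₁) (hc₂ : 0 ≤ c₂)
    (hK : 0 ≤ K) : 0 < errorConst L ν₀ c₁ c₂ K := by
  have := forcingConst_nonneg L hν₀ hc₁ hc₂ hK
  rw [errorConst]; positivity

section ErrorEstimate

variable {XR : Submodule ℝ (X Ω)} {QM : Submodule ℝ (L2S Ω)}
  {L ν ν₀ ε Δt c₁ c₂ K T α I J P : ℝ} {N : ℕ} {f w : ℕ → L2V Ω} {u uR η ξ : ℕ → X Ω}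
  {p pM κ π : ℕ → L2S Ω}

lemma discrete_error_estimate (hL : IsFormBound Ω L) (hν : 0 < ν) (hν₀ : ν ≤ ν₀) (hΔt : 0 < Δt)
    (hT : Δt * N = T) (hc₁ : 0 < c₁) (hc₂ : 0 ≤ c₂) (hε₁ : c₁ * Δt ≤ ε) (hε₂ : ε ≤ c₂ * Δt)
    (hK₀ : 0 ≤ K) (hI₀ : 0 ≤ I) (hJ₀ : 0 ≤ J) (hα : 0 ≤ α) (hα₁ : α ≤ 1)
    (hNS : IsSampledNSE ν N f u w p) (hrom : IsACROM XR QM ν ε Δt N f uR pM)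
    (he : IsErrorSplitting XR QM N u uR η ξ p pM κ π)
    (hdata : ‖vel (uR 0)‖ ^ 2 + ν * Δt * ‖grad (uR 0)‖ ^ 2 + ε * ‖pM 0‖ ^ 2
        + 4 * Δt / ν * ∑ n ∈ Finset.range N, negNorm (f (n + 1)) ^ 2 ≤ K)
    (hK : ∀ n < N, ‖grad (u (n + 1))‖ ≤ K) (hP : ∀ n < N, ‖p (n + 1) - p n‖ ≤ Δt * P)
    (hI : ∑ n ∈ Finset.range N, ‖truncErr Δt u w n‖ ^ 2 ≤ Δt * I)
    (hJ : ∑ n ∈ Finset.range N, ‖grad (u (n + 1) - u n)‖ ^ 2 ≤ Δt * J)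
    (hangle : ∀ n < N, inner ℝ (divg (η (n + 1))) (π (n + 1))
      ≤ α * (‖divg (η (n + 1))‖ * ‖π (n + 1)‖)) :
    errEnergy ν ε Δt N (fun n => u n - uR n) (fun n => p n - pM n)
      ≤ errEnergy ν ε Δt N η κ + errorConst L ν₀ c₁ c₂ K
        * Real.exp (errorRate L ν₀ c₁ K * T / ν ^ 3)
        * (‖vel (ξ 0)‖ ^ 2 + ε * ‖π 0‖ ^ 2 + Δt * ν * ‖grad (ξ 0)‖ ^ 2
          + approxData ν Δt α N η κ I J P) := by
  have hε₀ : 0 < ε := (mul_pos hc₁ hΔt).trans_le hε₁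
  have hν₀' : 0 < ν₀ := hν.trans_le hν₀
  have hT₀ : 0 ≤ T := hT ▸ by positivity
  have henergy₀ : 0 ≤ discEnergy ν ε Δt (ξ 0) (π 0) := by rw [discEnergy]; positivity
  have hgronwall := discrete_gronwall (S := fun n => discEnergy ν ε Δt (ξ n) (π n))
    (a := Δt * (49 / 2 * L ^ 4 * K ^ 4 / ν ^ 3 + 1 / c₁ + 1)) (by positivity) henergy₀
    (fun n => by rw [stepDissipation]; positivity)
    (fun n => by have := consistencySq_nonneg Δt u w uR η κ n; rw [pressureForcing]; positivity)
    fun n hn => error_energy_step hL hν hν₀ hΔt hc₁ hε₁ hα hNS hrom he hn (hK n hn) (hP n hn)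
      (hangle n hn)
  have hforcing := sum_forcing_le (L := L) (P := P) (η := η) (κ := κ) hν hν₀ hΔt hT hc₁ hc₂
    (pow_le_one₀ hα hα₁) hε₂ hK₀ hI₀ hJ₀
    (fun n hn => hrom.sq_norm_vel_le hL hν hε₀.le hΔt hdata hn.le)
    (hrom.sum_sq_norm_grad_le hL hν hε₀.le hΔt hdata) hI hJ
  have hA := forcingConst_nonneg L hν₀'.le hc₁ hc₂ hK₀
  have hη : 1 / ν * discL2sq Δt N (fun n => grad (η n)) ≤ approxData ν Δt α N η κ I J P :=
    (mul_le_mul_of_nonneg_right (le_add_of_nonneg_right (by positivity))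
      (discL2sq_nonneg hΔt.le N _)).trans (mul_discL2sq_le_approxData hν.le hΔt.le hI₀ hJ₀)
  have hρ : 0 ≤ errorRate L ν₀ c₁ K * T / ν ^ 3 :=
    div_nonneg (mul_nonneg (errorRate_pos L K hν₀' hc₁).le hT₀) (pow_nonneg hν.le 3)
  refine he.errEnergy_le_of_discEnergy_le hν hν₀ hε₀.le hΔt.le hA hρ hη ?_
  set A := forcingConst L ν₀ c₁ c₂ K
  set W := approxData ν Δt α N η κ I J P
  set D₀ := discEnergy ν ε Δt (ξ 0) (π 0)
  set r := 49 / 2 * L ^ 4 * K ^ 4 / ν ^ 3 + 1 / c₁ + 1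
  have hsum₀ : 0 ≤ D₀ + A * W := add_nonneg henergy₀ <| mul_nonneg hA <|
    approxData_nonneg hν.le hΔt.le hI₀ hJ₀
  calc _ ≤ Real.exp (N * (Δt * r)) * (D₀ + _) := hgronwall
    _ ≤ Real.exp (T * r) * (Real.exp T * D₀ + A * Real.exp T * W) := by
        rw [← mul_assoc, mul_comm (N : ℝ), hT]
        gcongr
        exact le_mul_of_one_le_left henergy₀ (Real.one_le_exp hT₀)
    _ = Real.exp (T * r + T) * (D₀ + A * W) := by rw [Real.exp_add]; ring
    _ ≤ _ := by gcongr; exact gronwall_exponent_le hν hν₀ hc₁ hT₀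

end ErrorEstimate

end ACROM

end

open ACROM MeasureTheory Set

theorem theorem5p1_general {d : ℕ} (hd : d = 2 ∨ d = 3) (Ω : Set (Pt d)) (hΩo : IsOpen Ω)
    (hΩb : Bornology.IsBounded Ω) (ν₀ c₁ c₂ K : ℝ) (hν₀ : 0 < ν₀) (hc₁ : 0 < c₁) :
    ∃ C : ℝ, 0 < C ∧ ∃ Ct : ℝ, 0 < Ct ∧
      ∀ (ν T ε Δt : ℝ) (N : ℕ), 0 < ν → ν ≤ ν₀ → 0 < T → 0 < N → Δt = T / N →
      c₁ * Δt ≤ ε → ε ≤ c₂ * Δt →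
      ∀ (f : ℝ → L2V Ω) (u₀ : X Ω) (u ut : ℝ → X Ω) (utt : ℝ → L2V Ω) (p pt : ℝ → L2S Ω),
      IsWeakNSE Ω ν T f u₀ u ut p → IsTimeRegular Ω T f u ut utt p pt →
      (∀ t ∈ Icc 0 T, ‖grad (u t)‖ ≤ K) →
      ∀ (R M : ℕ) (φ : Fin R → X Ω) (ψ : Fin M → L2S Ω),
      Orthonormal ℝ (fun j => vel (φ j)) → Orthonormal ℝ ψ →
      ∀ (uR : ℕ → X Ω) (pM : ℕ → L2S Ω),
      IsACROM (Submodule.span ℝ (range φ)) (Submodule.span ℝ (range ψ)) ν ε Δt N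
        (fun n => f (n * Δt)) uR pM →
      ‖vel (uR 0)‖ ^ 2 + ν * Δt * ‖grad (uR 0)‖ ^ 2 + ε * ‖pM 0‖ ^ 2
        + 4 * Δt / ν * ∑ n ∈ Finset.range N, negNorm (f ((n + 1 : ℕ) * Δt)) ^ 2 ≤ K →
      ∀ (η ξ eu : ℕ → X Ω) (κ π ep : ℕ → L2S Ω),
      (∀ n, η n = u (n * Δt) - velProj φ (u (n * Δt))) →
      (∀ n, ξ n = uR n - velProj φ (u (n * Δt))) →
      (∀ n, eu n = u (n * Δt) - uR n) →
      (∀ n, κ n = p (n * Δt) - presProj ψ (p (n * Δt))) →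
      (∀ n, π n = pM n - presProj ψ (p (n * Δt))) →
      (∀ n, ep n = p (n * Δt) - pM n) →
      errEnergy ν ε Δt N eu ep ≤ errEnergy ν ε Δt N η κ
        + C * Real.exp (Ct * T / ν ^ 3) *
          (‖vel (ξ 0)‖ ^ 2 + ε * ‖π 0‖ ^ 2 + Δt * ν * ‖grad (ξ 0)‖ ^ 2
            + approxData ν Δt (angleCos φ ψ) N η κ (∫ t in (0 : ℝ)..T, ‖utt t‖ ^ 2)
                (∫ t in (0 : ℝ)..T, ‖grad (ut t)‖ ^ 2)
                (eLpNorm pt ⊤ (volume.restrict (Ioc 0 T))).toReal) := by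
  obtain ⟨L, hL⟩ := exists_isFormBound hd hΩb
  have hK₀ := abs_nonneg K
  have hc₂ := abs_nonneg c₂
  refine ⟨errorConst L ν₀ c₁ |c₂| |K|, errorConst_pos L hν₀.le hc₁ hc₂ hK₀,
    errorRate L ν₀ c₁ |K|, errorRate_pos L |K| hν₀ hc₁, ?_⟩
  intro ν T ε Δt N hν hνν₀ hT hN hΔt hε₁ hε₂ f u₀ u ut utt p pt hNS hreg hu R M φ ψ hφ hψ uR pM
    hrom hdata η ξ eu κ π ep hη hξ heu hκ hπ hep
  obtain rfl : eu = _ := funext heu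
  obtain rfl : ep = _ := funext hep
  have hΔt₀ : 0 < Δt := hΔt ▸ by positivity
  have hΔtN : Δt * N = T := by rw [hΔt]; field_simp
  have hnode {n : ℕ} (hn : n ≤ N) : n * Δt ∈ Icc 0 T := mul_mem_Icc_of_le hΔtN hΔt₀.le hn
  obtain ⟨w, hw, hutw⟩ := hreg.exists_isPrimitiveOn_utt
  have hsampled := hNS.isSampledNSE hL hΩo hΩb hT hreg hw hutw fun n => hnode (n := n)
  have hsplit := isErrorSplitting_proj hφ hψ hrom (fun n => u (n * Δt)) fun n => p (n * Δt)
  rw [← funext hη, ← funext hξ, ← funext hκ, ← funext hπ] at hsplit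
  have hutt₀ : 0 ≤ ∫ t in (0 : ℝ)..T, ‖utt t‖ ^ 2 :=
    intervalIntegral.integral_nonneg hT.le fun _ _ => sq_nonneg _
  have hut₀ : 0 ≤ ∫ t in (0 : ℝ)..T, ‖grad (ut t)‖ ^ 2 :=
    intervalIntegral.integral_nonneg hT.le fun _ _ => sq_nonneg _
  refine discrete_error_estimate hL hν hνν₀ hΔt₀ hΔtN hc₁ hc₂ hε₁
    (hε₂.trans (by gcongr; exact le_abs_self c₂)) hK₀ hutt₀ hut₀ (angleCos_nonneg φ ψ)
    (Real.cos_le_one _) hsampled hrom hsplit (hdata.trans (le_abs_self K))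
    (fun n hn => (hu _ (hnode hn)).trans (le_abs_self K)) ?_ ?_
    (hreg.sum_sq_norm_grad_sub_le hΔtN hΔt₀.le) fun n hn => ?_
  · exact fun n hn => norm_step_sub_le hΔtN hΔt₀.le hreg.isPrimitiveOn_p hreg.pt_mem hn
  · exact hreg.sum_sq_norm_truncErr_le hw hutw hΔtN hΔt₀
  · rw [hη]
    exact (le_abs_self _).trans
      (abs_inner_divg_le_angleCos φ ψ (hsampled.divg_eq_zero _ hn) (hsplit.mem_QM _ hn))

theorem theorem5p1 {d : ℕ} (hd : d = 2 ∨ d = 3) (Ω : Set (Pt d)) (hΩo : IsOpen Ω)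
    (hΩb : Bornology.IsBounded Ω) (ν₀ c₁ c₂ K : ℝ) (hν₀ : 0 < ν₀) (hc₁ : 0 < c₁) :
    ∃ C : ℝ, 0 < C ∧ ∃ Ct : ℝ, 0 < Ct ∧
      ∀ (ν T ε Δt : ℝ) (N : ℕ), 0 < ν → ν ≤ ν₀ → 0 < T → 0 < N → Δt = T / N →
      c₁ * Δt ≤ ε → ε ≤ c₂ * Δt →
      -- the exact solution
      ∀ (f : ℝ → L2V Ω) (u₀ : X Ω) (u ut : ℝ → X Ω) (utt : ℝ → L2V Ω) (p pt : ℝ → L2S Ω),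
      IsWeakNSE Ω ν T f u₀ u ut p → IsTimeRegular Ω T f u ut utt p pt →
      (∀ t ∈ Icc 0 T, ‖grad (u t)‖ ≤ K) →
      -- the POD bases and the reduced order solution
      ∀ (kV kP R M : ℕ) (sV : Fin kV → X Ω) (sP : Fin kP → L2S Ω)
        (φ : Fin R → X Ω) (ψ : Fin M → L2S Ω),
      (∀ n, MeanZero (sP n)) → IsVelPOD sV φ → IsPresPOD sP ψ →
      ∀ (uR : ℕ → X Ω) (pM : ℕ → L2S Ω),
      IsACROM (Submodule.span ℝ (range φ)) (Submodule.span ℝ (range ψ)) ν ε Δt N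
        (fun n => f (n * Δt)) uR pM →
      ‖vel (uR 0)‖ ^ 2 + ν * Δt * ‖grad (uR 0)‖ ^ 2 + ε * ‖pM 0‖ ^ 2
        + 4 * Δt / ν * ∑ n ∈ Finset.range N, negNorm (f ((n + 1 : ℕ) * Δt)) ^ 2 ≤ K →
      -- projection errors, discrete errors, total errors
      ∀ (η ξ eu : ℕ → X Ω) (κ π ep : ℕ → L2S Ω),
      (∀ n, η n = u (n * Δt) - velProj φ (u (n * Δt))) →
      (∀ n, ξ n = uR n - velProj φ (u (n * Δt))) →
      (∀ n, eu n = u (n * Δt) - uR n) →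
      (∀ n, κ n = p (n * Δt) - presProj ψ (p (n * Δt))) →
      (∀ n, π n = pM n - presProj ψ (p (n * Δt))) →
      (∀ n, ep n = p (n * Δt) - pM n) →
      errEnergy ν ε Δt N eu ep ≤ errEnergy ν ε Δt N η κ
        + C * Real.exp (Ct * T / ν ^ 3) *
          (‖vel (ξ 0)‖ ^ 2 + ε * ‖π 0‖ ^ 2 + Δt * ν * ‖grad (ξ 0)‖ ^ 2
            + (1 / ν + angleCos φ ψ ^ 2 * Δt⁻¹) * discL2sq Δt N (fun n => grad (η n))
            + 1 / ν * discL2sq Δt N κ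
            + Δt ^ 2 / ν * (∫ t in (0 : ℝ)..T, ‖utt t‖ ^ 2)
            + Δt ^ 2 / ν * (∫ t in (0 : ℝ)..T, ‖grad (ut t)‖ ^ 2)
            + Δt ^ (1 / 2 : ℝ) / ν ^ (3 / 2 : ℝ)
                * (∑ n ∈ Finset.range N, ‖grad (η (n + 1))‖ ^ 4) ^ (1 / 2 : ℝ)
            + Δt ^ 3 * (∫ t in (0 : ℝ)..T, ‖pt t‖ ^ 2)
            + Δt * (eLpNorm pt ⊤ (volume.restrict (Ioc 0 T))).toReal ^ 2) := by
  obtain ⟨C, hC, Ct, hCt, hbound⟩ := theorem5p1_general hd Ω hΩo hΩb ν₀ c₁ c₂ K hν₀ hc₁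
  refine ⟨C, hC, Ct, hCt, fun ν T ε Δt N hν hνν₀ hT hN hΔt hε₁ hε₂ f u₀ u ut utt p pt hNS hreg hu
    kV kP R M sV sP φ ψ _ hφ hψ uR pM hrom hdata η ξ eu κ π ep hη hξ heu hκ hπ hep =>
    (hbound ν T ε Δt N hν hνν₀ hT hN hΔt hε₁ hε₂ f u₀ u ut utt p pt hNS hreg hu R M φ ψ hφ.1 hψ.1
      uR pM hrom hdata η ξ eu κ π ep hη hξ heu hκ hπ hep).trans ?_⟩
  have hpt : 0 ≤ Δt ^ 3 * ∫ t in (0 : ℝ)..T, ‖pt t‖ ^ 2 := mul_nonneg (hΔt ▸ by positivity)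
    (intervalIntegral.integral_nonneg hT.le fun _ _ => sq_nonneg _)
  refine add_le_add_right (mul_le_mul_of_nonneg_left ?_ (by positivity)) _
  rw [approxData]
  linarith
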